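/- Let $n \ge 1$, let $J = \begin{pmatrix} 0 & I_n \\ -I_n & 0\end{pmatrix}$, and put $\nu(x,y) = x^t J y$ for $x,y \in \mathbb Z^{2n}$. Let $\Gamma$ be a subgroup of $Sp(2n,\mathbb Z) = \{A : A^tJA = J\}$, acting on $\mathbb Z^{2n}$ by matrix multiplication. For each $\alpha \in \mathbb T$ fix a square root $\alpha^{1/2} \in \mathbb T$ (any choice), let $\nu_\alpha$ be the $\mathbb T$-valued 2-cocycle $$\nu_\alpha\big((x_1,\gamma_1),(x_2,\gamma_2)\big) = (\alpha^{1/2})^{\nu(x_1,\gamma_1x_2)}$$ on $G = \mathbb Z^{2n} \rtimes \Gamma$, and let $M_\alpha(\Gamma,n) = L_{\nu_\alpha}(G) = \lambda_{\nu_\alpha}(G)''$ be the von Neumann algebra on $\ell^2(G)$ generated by the operators $\lambda_{\nu_\alpha}(g)\xi_h = \nu_\alpha(g,h)\,\xi_{gh}$, where $(\xi_h)_{h\in G}$ is the canonical basis. An amplification of a von Neumann algebra $N$ is an algebra $p M_k(N) p$ with $k \in \mathbb N$ and $p \in M_k(N)$ a non-zero projection; $M$ is stably isomorphic to $N$ if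 $M$ is $*$-isomorphic to an amplification of $N$. Assume that $\mathbb Z^{2n} \subset \mathbb Z^{2n} \rtimes \Gamma$ has the relative property (T): there are $\delta > 0$ and a finite set $F \subset G$ such that every unitary representation $\pi$ of $G$ with a unit vector $\xi$ satisfying $\|\pi(g)\xi - \xi\| < \delta$ for all $g \in F$ has a non-zero vector fixed by $\pi(\mathbb Z^{2n})$. Then: 1. For every separable $\mathrm{II}_1$ factor $M$ (a $\mathrm{II}_1$ factor on a separable Hilbert space), the set of $\alpha \in \mathbb T$ for which some amplification of $M_\alpha(\Gamma,n)$ embeds into $M$ (by an injective, not necessarily unital, $*$-homomorphism) is at most countable. 2. Consequently the algebras $M_\alpha(\Gamma,n)$, $\alpha \in \mathbb T$, are non stably isomorphic modulo countable sets: for every $\alpha_0 \in \mathbb T$, the set of $\alpha \in \mathbb T$ for which $M_\alpha(\Gamma,n)$ is stably isomorphic to $M_{\alpha_0}(\Gamma,n)$ is at most countable. -/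

import Mathlib

open scoped Matrix InnerProductSpace ENNReal

/-! ### Relative property (T) -/

/-- The inclusion `H ⊂ G` of discrete groups has the relative property (T) of Kazhdan-Margulis:
there are `δ > 0` and a finite `F ⊂ G` such that every unitary representation of `G` with a unit
vector that is moved by less than `δ` by all elements of `F` has a non-zero `H`-invariant vector.
(The groups used below are countable. The closed span of the orbit of one vector is then
separable, so it makes no difference in which universe the Hilbert spaces live.) -/
def HasRelativePropertyT {G : Type} [Group G] (H : Subgroup G) : Prop :=
  ∃ δ : ℝ, 0 < δ ∧ ∃ F : Finset G,
    ∀ (K : Type) [NormedAddCommGroup K] [InnerProductSpace ℂ K] [CompleteSpace K]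
      (π : G →* unitary (K →L[ℂ] K)) (ξ : K), ‖ξ‖ = 1 →
      (∀ g ∈ F, ‖(π g : K →L[ℂ] K) ξ - ξ‖ < δ) →
      ∃ ξ₀ : K, ξ₀ ≠ 0 ∧ ∀ h ∈ H, (π h : K →L[ℂ] K) ξ₀ = ξ₀

/-! ### Von Neumann algebras, II₁ factors, amplifications -/

section VonNeumann

open scoped ComplexOrder

variable {K : Type*} [NormedAddCommGroup K] [InnerProductSpace ℂ K] [CompleteSpace K]

/-- The von Neumann algebra generated by a set `S` of bounded operators: the double commutant of
`S ∪ S*`. -/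
noncomputable def vonNeumannGenerated (S : Set (K →L[ℂ] K)) : VonNeumannAlgebra K where
  toStarSubalgebra :=
    StarSubalgebra.centralizer ℂ (StarSubalgebra.centralizer ℂ S : Set (K →L[ℂ] K))
  centralizer_centralizer' := by
    change Set.centralizer (Set.centralizer
      (StarSubalgebra.centralizer ℂ (StarSubalgebra.centralizer ℂ S : Set (K →L[ℂ] K)) :
        Set (K →L[ℂ] K))) =
      (StarSubalgebra.centralizer ℂ (StarSubalgebra.centralizer ℂ S : Set (K →L[ℂ] K)) :
        Set (K →L[ℂ] K))
    simp [StarSubalgebra.coe_centralizer]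

/-- A linear functional on a von Neumann algebra is normal (that is, `σ`-weakly continuous):
`φ x = ∑ ⟨x ξᵢ, ηᵢ⟩` with `∑ ‖ξᵢ‖² < ∞` and `∑ ‖ηᵢ‖² < ∞`. -/
def IsNormalFunctional {M : VonNeumannAlgebra K} (φ : M.toStarSubalgebra →ₗ[ℂ] ℂ) : Prop :=
  ∃ ξ η : ℕ → K, (Summable fun i => ‖ξ i‖ ^ 2) ∧ (Summable fun i => ‖η i‖ ^ 2) ∧
    ∀ x : M.toStarSubalgebra, HasSum (fun i => ⟪η i, (x : K →L[ℂ] K) (ξ i)⟫_ℂ) (φ x)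

/-- A faithful normal tracial state. -/
structure IsFaithfulNormalTrace {M : VonNeumannAlgebra K}
    (τ : M.toStarSubalgebra →ₗ[ℂ] ℂ) : Prop where
  normal : IsNormalFunctional τ
  map_one : τ 1 = 1
  trace : ∀ x y, τ (x * y) = τ (y * x)
  nonneg : ∀ x, 0 ≤ τ (star x * x)
  faithful : ∀ x, τ (star x * x) = 0 → x = 0

/-- A II₁ factor: an infinite-dimensional von Neumann algebra with trivial centre that has a
faithful normal tracial state. -/
structure IsIIOneFactor (M : VonNeumannAlgebra K) : Prop where
  center_trivial : ∀ x ∈ M, x ∈ M.commutant → ∃ c : ℂ, x = c • (1 : K →L[ℂ] K)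
  infinite_dimensional : ¬ FiniteDimensional ℂ M.toStarSubalgebra
  exists_trace : ∃ τ : M.toStarSubalgebra →ₗ[ℂ] ℂ, IsFaithfulNormalTrace τ

end VonNeumann

section Amplification

/-- The corner `p A p = {x | p x = x = x p}` of a `*`-algebra `A` at a projection `p`. -/
def starCorner {A : Type*} [Ring A] [StarRing A] [Algebra ℂ A] [StarModule ℂ A]
    (p : A) (hp : IsStarProjection p) : NonUnitalStarSubalgebra ℂ A where
  carrier := {x | p * x = x ∧ x * p = x}
  add_mem' := fun {a b} ha hb => ⟨by rw [mul_add, ha.1, hb.1], by rw [add_mul, ha.2, hb.2]⟩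
  zero_mem' := ⟨mul_zero p, zero_mul p⟩
  mul_mem' := fun {a b} ha hb => ⟨by rw [← mul_assoc, ha.1], by rw [mul_assoc, hb.2]⟩
  smul_mem' := fun c {a} ha => ⟨by rw [mul_smul_comm, ha.1], by rw [smul_mul_assoc, ha.2]⟩
  star_mem' := fun {a} ha => by
    have hs : star p = p := hp.isSelfAdjoint.star_eq
    refine ⟨?_, ?_⟩
    · have h := congrArg star ha.2
      rwa [star_mul, hs] at h
    · have h := congrArg star ha.1
      rwa [star_mul, hs] at h

/-- Some amplification `p M_k(N) p` of `N` (`p` a non-zero projection of `M_k(N)`) embeds into `M`,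
not necessarily unitally. The embedding is an arbitrary injective `*`-homomorphism; between
II₁ factors these are automatically normal. -/
def SomeAmplificationEmbeds (N M : Type*) [Ring N] [StarRing N] [Algebra ℂ N] [StarModule ℂ N]
    [Ring M] [StarRing M] [Algebra ℂ M] [StarModule ℂ M] : Prop :=
  ∃ (k : ℕ) (p : Matrix (Fin k) (Fin k) N) (hp : IsStarProjection p), p ≠ 0 ∧
    ∃ f : starCorner p hp →⋆ₙₐ[ℂ] M, Function.Injective f

/-- `M` is stably isomorphic to `N`: it is `*`-isomorphic to an amplification `p M_k(N) p` of `N`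
(`*`-isomorphisms of von Neumann algebras are automatically normal). -/
def StablyIsomorphic (M N : Type*) [Ring M] [StarRing M] [Algebra ℂ M] [StarModule ℂ M]
    [Ring N] [StarRing N] [Algebra ℂ N] [StarModule ℂ N] : Prop :=
  ∃ (k : ℕ) (p : Matrix (Fin k) (Fin k) N) (hp : IsStarProjection p), p ≠ 0 ∧
    Nonempty (M ≃⋆ₐ[ℂ] starCorner p hp)

end Amplification

/-! ### Twisted group von Neumann algebras -/

section Twisted

variable {G : Type*} [Group G]

theorem twistedTranslate_memℓp (μ : G → G → Circle) (g : G) (f : lp (fun _ : G => ℂ) 2) :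
    Memℓp (fun k : G => (μ g (g⁻¹ * k) : ℂ) * f (g⁻¹ * k)) 2 := by
  have h := (memℓp_gen_iff (by norm_num : 0 < (2 : ℝ≥0∞).toReal)).1 (lp.memℓp f)
  refine (memℓp_gen_iff (by norm_num)).2 ?_
  simpa [Function.comp_def, Circle.norm_coe] using (Equiv.mulLeft g⁻¹).summable_iff.2 h

/-- The projective left regular representation `λ_μ` of `G` on `ℓ²(G)`,
`λ_μ(g) ξ_h = μ(g,h) ξ_{gh}`; in coordinates, `(λ_μ(g) f)(k) = μ(g, g⁻¹k) f(g⁻¹k)`. -/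
noncomputable def twistedRegular (μ : G → G → Circle) (g : G) :
    lp (fun _ : G => ℂ) 2 →L[ℂ] lp (fun _ : G => ℂ) 2 :=
  LinearIsometry.toContinuousLinearMap
    { toFun := fun f =>
        ⟨fun k => (μ g (g⁻¹ * k) : ℂ) * f (g⁻¹ * k), twistedTranslate_memℓp μ g f⟩
      map_add' := fun f f' => by
        ext k
        exact mul_add _ _ _
      map_smul' := fun c f => by
        ext k
        exact mul_left_comm _ _ _
      norm_map' := fun f => by
        rw [lp.norm_eq_tsum_rpow (by norm_num : 0 < (2 : ℝ≥0∞).toReal),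
          lp.norm_eq_tsum_rpow (by norm_num : 0 < (2 : ℝ≥0∞).toReal)]
        congr 1
        simpa [Circle.norm_coe] using (Equiv.mulLeft g⁻¹).tsum_eq (fun k => ‖f k‖ ^ (2 : ℝ≥0∞).toReal) }

/-- The twisted group von Neumann algebra `L_μ(G) = λ_μ(G)''` on `ℓ²(G)`. -/
noncomputable def twistedGroupVN (μ : G → G → Circle) :
    VonNeumannAlgebra (lp (fun _ : G => ℂ) 2) :=
  vonNeumannGenerated (Set.range (twistedRegular μ))

end Twisted

/-! ### The groups `ℤ²ⁿ ⋊ Γ`, the cocycles, and the algebras `M_α(Γ, n)` -/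

section Symplectic

/-- The lattice `ℤ²ⁿ`, with coordinates `(x₁, …, xₙ; xₙ₊₁, …, x₂ₙ)`. -/
abbrev ZLattice (n : ℕ) : Type := Fin n ⊕ Fin n → ℤ

/-- The action of `Sp(2n, ℤ)` on `ℤ²ⁿ` by matrix multiplication. -/
noncomputable def spAction (n : ℕ) :
    Matrix.symplecticGroup (Fin n) ℤ →* MulAut (Multiplicative (ZLattice n)) where
  toFun A := AddEquiv.toMultiplicative
    { toFun := fun x => (A : Matrix (Fin n ⊕ Fin n) (Fin n ⊕ Fin n) ℤ) *ᵥ x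
      invFun := fun x =>
        ((A⁻¹ : Matrix.symplecticGroup (Fin n) ℤ) : Matrix (Fin n ⊕ Fin n) (Fin n ⊕ Fin n) ℤ) *ᵥ x
      left_inv := fun x => by
        beta_reduce
        rw [Matrix.mulVec_mulVec, ← Submonoid.coe_mul, inv_mul_cancel, Submonoid.coe_one,
          Matrix.one_mulVec]
      right_inv := fun x => by
        beta_reduce
        rw [Matrix.mulVec_mulVec, ← Submonoid.coe_mul, mul_inv_cancel, Submonoid.coe_one,
          Matrix.one_mulVec]
      map_add' := fun x y => Matrix.mulVec_add _ x y }
  map_one' := by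
    ext x : 1
    exact congrArg Multiplicative.ofAdd (Matrix.one_mulVec (Multiplicative.toAdd x))
  map_mul' A B := by
    ext x : 1
    exact congrArg Multiplicative.ofAdd
      (Matrix.mulVec_mulVec (Multiplicative.toAdd x) A.1 B.1).symm

/-- The group `ℤ²ⁿ ⋊ Γ`, for a subgroup `Γ` of `Sp(2n, ℤ)`. -/
abbrev LatticeSemidirect (n : ℕ) (Γ : Subgroup (Matrix.symplecticGroup (Fin n) ℤ)) : Type :=
  Multiplicative (ZLattice n) ⋊[(spAction n).comp Γ.subtype] Γ

/-- The subgroup `ℤ²ⁿ` of `ℤ²ⁿ ⋊ Γ`. -/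
noncomputable def latticeSubgroup (n : ℕ) (Γ : Subgroup (Matrix.symplecticGroup (Fin n) ℤ)) :
    Subgroup (LatticeSemidirect n Γ) :=
  (SemidirectProduct.inl :
    Multiplicative (ZLattice n) →* LatticeSemidirect n Γ).range

/-- The integer 2-cocycle `ν(x, y) = xᵗ J y` on `ℤ²ⁿ`, where `J` is the block matrix
`(0, I; -I, 0)`. -/
def symplecticForm {n : ℕ} (x y : ZLattice n) : ℤ :=
  x ⬝ᵥ (Matrix.fromBlocks 0 1 (-1) 0 : Matrix (Fin n ⊕ Fin n) (Fin n ⊕ Fin n) ℤ) *ᵥ y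

/-- For `β` on the circle, the 2-cocycle `((x₁, γ₁), (x₂, γ₂)) ↦ β ^ ν(x₁, γ₁ x₂)` on `ℤ²ⁿ ⋊ Γ`. -/
noncomputable def latticeCocycle {n : ℕ} (Γ : Subgroup (Matrix.symplecticGroup (Fin n) ℤ))
    (β : Circle) (a b : LatticeSemidirect n Γ) : Circle :=
  β ^ symplecticForm (Multiplicative.toAdd a.left)
    ((a.right.1 : Matrix (Fin n ⊕ Fin n) (Fin n ⊕ Fin n) ℤ) *ᵥ Multiplicative.toAdd b.left)

/-- The von Neumann algebra `L_μ(ℤ²ⁿ ⋊ Γ)` for the cocycle `μ = β ^ ν`. With `β = α^{1/2}` this is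
`M_α(Γ, n)`, the cocycle being `ν_α = α^{ν/2}`. -/
noncomputable def cocycleVN {n : ℕ} (Γ : Subgroup (Matrix.symplecticGroup (Fin n) ℤ))
    (β : Circle) : VonNeumannAlgebra (lp (fun _ : LatticeSemidirect n Γ => ℂ) 2) :=
  twistedGroupVN (latticeCocycle Γ β)

end Symplectic

open scoped TensorProduct ComplexOrder
open UniformSpace (Completion)

universe u

/-! ### Separable Hilbert spaces and the universe of property (T) -/

/-- An orthonormal family in a separable inner product space is countable. -/
theorem Orthonormal.countable_of_separableSpace {ι E : Type*} [NormedAddCommGroup E]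
    [InnerProductSpace ℂ E] [TopologicalSpace.SeparableSpace E] {v : ι → E}
    (hv : Orthonormal ℂ v) : Countable ι := by
  have hd : (Set.univ : Set ι).PairwiseDisjoint fun i => Metric.ball (v i) (1 / 2) := by
    intro i _ j _ hij
    refine Metric.ball_disjoint_ball ?_
    have h : ‖v i - v j‖ ^ 2 = 2 := by
      rw [@norm_sub_sq ℂ, hv.1 i, hv.1 j, hv.2 hij]
      norm_num
    rw [dist_eq_norm]
    nlinarith [norm_nonneg (v i - v j)]
  rw [← Set.countable_univ_iff]
  exact hd.countable_of_isOpen (fun i _ => Metric.isOpen_ball)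
    (fun i _ => ⟨v i, Metric.mem_ball_self (by norm_num)⟩)

/-- A separable Hilbert space is isometric to some `ℓ²(ι)` with `ι` in the lowest universe. -/
theorem exists_linearIsometryEquiv_lp (E : Type u) [NormedAddCommGroup E]
    [InnerProductSpace ℂ E] [CompleteSpace E] [TopologicalSpace.SeparableSpace E] :
    ∃ ι : Type, Nonempty (E ≃ₗᵢ[ℂ] lp (fun _ : ι => ℂ) 2) := by
  obtain ⟨w, b, hb⟩ := exists_hilbertBasis ℂ E
  have : Countable w := b.orthonormal.countable_of_separableSpace
  obtain ⟨f, hf⟩ := Countable.exists_injective_nat w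
  let e : Set.range f ≃ w := (Equiv.ofInjective f hf).symm
  have ho : Orthonormal ℂ (b ∘ e) := b.orthonormal.comp e e.injective
  refine ⟨Set.range f, ⟨(HilbertBasis.mk ho ?_).repr⟩⟩
  rw [e.surjective.range_comp, b.dense_span]

/-- Relative property (T), tested on Hilbert spaces of an arbitrary universe. -/
theorem HasRelativePropertyT.exists_fixed {G : Type} [Group G] [Countable G] {H : Subgroup G}
    (hT : HasRelativePropertyT H) : ∃ δ : ℝ, 0 < δ ∧ ∃ F : Finset G,
    ∀ (K : Type u) [NormedAddCommGroup K] [InnerProductSpace ℂ K] [CompleteSpace K]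
      (π : G →* (K ≃ₗᵢ[ℂ] K)) (ξ : K), ‖ξ‖ = 1 → (∀ g ∈ F, ‖π g ξ - ξ‖ < δ) →
      ∃ ξ₀ : K, ξ₀ ≠ 0 ∧ ∀ h ∈ H, π h ξ₀ = ξ₀ := by
  obtain ⟨δ, hδ, F, hF⟩ := hT
  refine ⟨δ, hδ, F, fun K _ _ _ π ξ hξ hinv => ?_⟩
  -- The closed cyclic subspace of `ξ` is separable because `G` is countable, so the restricted
  -- representation can be moved to an `ℓ²` space in the lowest universe.
  let S₀ : Submodule ℂ K := Submodule.span ℂ (Set.range fun g => π g ξ)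
  let S : Submodule ℂ K := S₀.topologicalClosure
  have hS₀ : ∀ g, ∀ x ∈ S₀, π g x ∈ S₀ := fun g x hx => by
    induction hx using Submodule.span_induction with
    | mem x hx =>
      obtain ⟨h, rfl⟩ := hx
      refine Submodule.subset_span ⟨g * h, ?_⟩
      simp [map_mul]
    | zero => simp
    | add x y _ _ hx hy => rw [map_add]; exact S₀.add_mem hx hy
    | smul c x _ hx => rw [map_smul]; exact S₀.smul_mem c hx
  have hS : ∀ g, ∀ x ∈ S, π g x ∈ S := fun g x hx =>
    map_mem_closure (π g).continuous hx (hS₀ g)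
  have hξS : ξ ∈ S := subset_closure (Submodule.subset_span ⟨1, by simp⟩)
  have : CompleteSpace S := S₀.isClosed_topologicalClosure.completeSpace_coe
  have : TopologicalSpace.SeparableSpace S := by
    have h : TopologicalSpace.IsSeparable (S : Set K) :=
      ((Set.countable_range fun g => π g ξ).isSeparable.span (R := ℂ)).closure
    exact h.separableSpace
  let σ : G →* (S ≃ₗᵢ[ℂ] S) :=
    { toFun := fun g =>
        { toFun := fun x => ⟨π g x, hS g x x.2⟩
          invFun := fun x => ⟨π g⁻¹ x, hS g⁻¹ x x.2⟩
          map_add' := fun x y => Subtype.ext (map_add (π g) _ _)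
          map_smul' := fun c x => Subtype.ext (map_smul (π g) c _)
          left_inv := fun x => Subtype.ext (by
            change (π g⁻¹ * π g) x = x
            rw [← map_mul]; simp)
          right_inv := fun x => Subtype.ext (by
            change (π g * π g⁻¹) x = x
            rw [← map_mul]; simp)
          norm_map' := fun x => (π g).norm_map x }
      map_one' := by ext x; simp
      map_mul' := fun g h => by ext x; simp }
  obtain ⟨ι, ⟨T⟩⟩ := exists_linearIsometryEquiv_lp S
  let ρ : G →* (lp (fun _ : ι => ℂ) 2 ≃ₗᵢ[ℂ] lp (fun _ : ι => ℂ) 2) :=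
    { toFun := fun g => (T.symm.trans (σ g)).trans T
      map_one' := by ext x : 1; simp
      map_mul' := fun g h => by ext x : 1; simp }
  let ρ' := (Unitary.linearIsometryEquiv (𝕜 := ℂ) (H := lp (fun _ : ι => ℂ) 2)).symm.toMonoidHom.comp ρ
  have hρ' : ∀ g x, (ρ' g : _ →L[ℂ] _) x = T (σ g (T.symm x)) := fun g x => rfl
  obtain ⟨η, hη, hfix⟩ := hF _ ρ' (T ⟨ξ, hξS⟩) (by rw [T.norm_map]; exact hξ) (fun g hg => by
    rw [hρ', ← map_sub, T.norm_map, T.symm_apply_apply]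
    exact hinv g hg)
  refine ⟨T.symm η, by simpa using hη, fun h hh => ?_⟩
  have := congrArg T.symm (hfix h hh)
  rw [hρ', T.symm_apply_apply] at this
  exact congrArg Subtype.val this

/-! ### Hilbert tensor products and vectors fixed by almost commuting unitaries -/

section TensorCompletion

variable {E E' : Type*} [NormedAddCommGroup E] [InnerProductSpace ℂ E]
  [NormedAddCommGroup E'] [InnerProductSpace ℂ E']

/-- An isometric automorphism of a normed space extends to the completion. -/
noncomputable def LinearIsometryEquiv.completion {V : Type*} [NormedAddCommGroup V]
    [NormedSpace ℂ V] (f : V ≃ₗᵢ[ℂ] V) : Completion V ≃ₗᵢ[ℂ] Completion V where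
  toFun := (f.toContinuousLinearEquiv : V →L[ℂ] V).completion
  invFun := (f.symm.toContinuousLinearEquiv : V →L[ℂ] V).completion
  map_add' := _root_.map_add ((f.toContinuousLinearEquiv : V →L[ℂ] V).completion)
  map_smul' := ((f.toContinuousLinearEquiv : V →L[ℂ] V).completion).map_smul
  left_inv x := by
    induction x using Completion.induction_on with
    | hp => exact isClosed_eq (by fun_prop) continuous_id
    | ih v => simp
  right_inv x := by
    induction x using Completion.induction_on with
    | hp => exact isClosed_eq (by fun_prop) continuous_id
    | ih v => simp
  norm_map' x := by
    induction x using Completion.induction_on with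
    | hp => exact isClosed_eq (continuous_norm.comp (ContinuousLinearMap.continuous _)) continuous_norm
    | ih v =>
      change ‖(f.toContinuousLinearEquiv : V →L[ℂ] V).completion v‖ = _
      simp

theorem LinearIsometryEquiv.completion_coe {V : Type*} [NormedAddCommGroup V]
    [NormedSpace ℂ V] (f : V ≃ₗᵢ[ℂ] V) (v : V) : f.completion (v : Completion V) = (f v : V) := by
  change (f.toContinuousLinearEquiv : V →L[ℂ] V).completion v = _
  simp

/-- The isometric automorphism `f ⊗ g` of the Hilbert space tensor product. -/
noncomputable def hilbertTensor (f : E ≃ₗᵢ[ℂ] E) (g : E' ≃ₗᵢ[ℂ] E') :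
    Completion (E ⊗[ℂ] E') ≃ₗᵢ[ℂ] Completion (E ⊗[ℂ] E') :=
  (TensorProduct.congrIsometry f g).completion

theorem hilbertTensor_coe (f : E ≃ₗᵢ[ℂ] E) (g : E' ≃ₗᵢ[ℂ] E') (z : E ⊗[ℂ] E') :
    hilbertTensor f g (z : Completion (E ⊗[ℂ] E')) =
      (TensorProduct.congrIsometry f g z : E ⊗[ℂ] E') :=
  LinearIsometryEquiv.completion_coe _ _

theorem hilbertTensor_tmul (f : E ≃ₗᵢ[ℂ] E) (g : E' ≃ₗᵢ[ℂ] E') (x : E) (y : E') :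
    hilbertTensor f g ((x ⊗ₜ[ℂ] y : E ⊗[ℂ] E') : Completion (E ⊗[ℂ] E')) =
      (f x ⊗ₜ[ℂ] g y : E ⊗[ℂ] E') := by
  rw [hilbertTensor_coe]
  rfl

theorem hilbertTensor_ext {T S : Completion (E ⊗[ℂ] E') →L[ℂ] Completion (E ⊗[ℂ] E')}
    (h : ∀ x y, T ((x ⊗ₜ[ℂ] y : E ⊗[ℂ] E') : Completion (E ⊗[ℂ] E')) =
      S ((x ⊗ₜ[ℂ] y : E ⊗[ℂ] E') : Completion (E ⊗[ℂ] E'))) : T = S := by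
  ext z
  induction z using Completion.induction_on with
  | hp => exact isClosed_eq T.continuous S.continuous
  | ih z =>
    induction z with
    | zero => rw [Completion.coe_zero, map_zero, map_zero]
    | tmul x y => exact h x y
    | add a b ha hb => simp only [Completion.coe_add, map_add, ha, hb]

/-- Both sides are continuous and linear, so elementary tensors suffice, and there the two scalars
multiply. This one rule covers projective multiplicativity and commutation up to a scalar. -/
theorem hilbertTensor_intertwine {f₁ f₂ f₃ f₄ : E ≃ₗᵢ[ℂ] E} {g₁ g₂ g₃ g₄ : E' ≃ₗᵢ[ℂ] E'} {c d : ℂ}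
    (hf : ∀ x, f₁ (f₂ x) = c • f₃ (f₄ x)) (hg : ∀ y, g₁ (g₂ y) = d • g₃ (g₄ y))
    (z : Completion (E ⊗[ℂ] E')) :
    hilbertTensor f₁ g₁ (hilbertTensor f₂ g₂ z) =
      (c * d) • hilbertTensor f₃ g₃ (hilbertTensor f₄ g₄ z) := by
  let T := (hilbertTensor f₁ g₁).toContinuousLinearEquiv.toContinuousLinearMap ∘L
    (hilbertTensor f₂ g₂).toContinuousLinearEquiv.toContinuousLinearMap
  let S := (c * d) • ((hilbertTensor f₃ g₃).toContinuousLinearEquiv.toContinuousLinearMap ∘L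
    (hilbertTensor f₄ g₄).toContinuousLinearEquiv.toContinuousLinearMap)
  have h : T = S := hilbertTensor_ext fun x y => by
    change hilbertTensor f₁ g₁ (hilbertTensor f₂ g₂ _) =
      (c * d) • hilbertTensor f₃ g₃ (hilbertTensor f₄ g₄ _)
    simp only [hilbertTensor_tmul, hf, hg, TensorProduct.smul_tmul_smul, Completion.coe_smul]
  exact congrArg (fun R => R z) h

theorem hilbertTensor_one (z : Completion (E ⊗[ℂ] E')) :
    hilbertTensor (1 : E ≃ₗᵢ[ℂ] E) (1 : E' ≃ₗᵢ[ℂ] E') z = z :=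
  congrArg (fun R => R z) (hilbertTensor_ext (S := ContinuousLinearMap.id ℂ _)
    (T := (hilbertTensor (1 : E ≃ₗᵢ[ℂ] E) (1 : E' ≃ₗᵢ[ℂ] E')).toContinuousLinearEquiv.toContinuousLinearMap)
    fun x y => hilbertTensor_tmul _ _ x y)

theorem hilbertTensor_mul {f₁ f₂ f₃ : E ≃ₗᵢ[ℂ] E} {g₁ g₂ g₃ : E' ≃ₗᵢ[ℂ] E'} {c d : ℂ}
    (hf : ∀ x, f₁ (f₂ x) = c • f₃ x) (hg : ∀ y, g₁ (g₂ y) = d • g₃ y)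
    (z : Completion (E ⊗[ℂ] E')) :
    hilbertTensor f₁ g₁ (hilbertTensor f₂ g₂ z) = (c * d) • hilbertTensor f₃ g₃ z := by
  have h := hilbertTensor_intertwine (f₄ := 1) (g₄ := 1) hf hg z
  rwa [hilbertTensor_one] at h

/-- An orthonormal sequence does not stay close to a finite-dimensional subspace. -/
theorem Orthonormal.not_near_finiteDimensional {W : Type*} [NormedAddCommGroup W]
    [InnerProductSpace ℂ W] {X : ℕ → W} (hX : Orthonormal ℂ X) (D : Submodule ℂ W)
    [FiniteDimensional ℂ D] {d : ℕ → W} (hd : ∀ k, d k ∈ D) : ¬ ∀ k, ‖X k - d k‖ ≤ 1 / 4 := by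
  intro hXd
  let d' : ℕ → D := fun k => ⟨d k, hd k⟩
  have hb : ∀ k, d' k ∈ Metric.closedBall (0 : D) 2 := fun k => by
    rw [mem_closedBall_zero_iff]
    change ‖d k‖ ≤ 2
    have h1 : ‖d k‖ ≤ ‖X k‖ + ‖X k - d k‖ := by
      have := norm_sub_le (X k) (X k - d k)
      rwa [sub_sub_cancel] at this
    rw [hX.1 k] at h1
    linarith [hXd k]
  -- By compactness some `d` values get within `1/4` of each other, so two of the orthonormal
  -- vectors would be at distance at most `1`, whereas their distance is `√2`.
  have := FiniteDimensional.proper ℂ D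
  obtain ⟨a, _, φ, hφ, hlim⟩ := (isCompact_closedBall (0 : D) 2).tendsto_subseq hb
  obtain ⟨N, hN⟩ := Metric.cauchySeq_iff'.1 hlim.cauchySeq (1 / 4) (by norm_num)
  have h1 := hN (N + 1) (Nat.le_succ N)
  have hne : φ (N + 1) ≠ φ N := (hφ (Nat.lt_succ_self N)).ne'
  have h2 : ‖X (φ (N + 1)) - X (φ N)‖ ^ 2 = 2 := by
    rw [@norm_sub_sq ℂ, hX.1, hX.1, hX.2 hne]
    norm_num
  have h3 : ‖d (φ (N + 1)) - d (φ N)‖ < 1 / 4 := by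
    rw [dist_eq_norm] at h1
    exact h1
  have h4 : X (φ (N + 1)) - X (φ N) = (X (φ (N + 1)) - d (φ (N + 1))) +
      (d (φ (N + 1)) - d (φ N)) - (X (φ N) - d (φ N)) := by abel
  have h5 : ‖X (φ (N + 1)) - X (φ N)‖ ≤ 1 := by
    rw [h4]
    refine (norm_sub_le _ _).trans ?_
    have := norm_add_le (X (φ (N + 1)) - d (φ (N + 1))) (d (φ (N + 1)) - d (φ N))
    linarith [hXd (φ (N + 1)), hXd (φ N)]
  nlinarith [norm_nonneg (X (φ (N + 1)) - X (φ N))]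

/-- A vector `Ξ` of a Hilbert tensor product moves along `(f ⊗ 1) Ξ` near a fixed
finite-dimensional subspace, as long as `f ⊗ f'` fixes `Ξ`. -/
theorem exists_finiteDimensional_near (Ξ : Completion (E ⊗[ℂ] E')) {ε : ℝ} (hε : 0 < ε) :
    ∃ D : Submodule ℂ (Completion (E ⊗[ℂ] E')), FiniteDimensional ℂ D ∧
      ∀ (f : E ≃ₗᵢ[ℂ] E) (f' : E' ≃ₗᵢ[ℂ] E'), hilbertTensor f f' Ξ = Ξ →
        ∃ d ∈ D, ‖hilbertTensor f (.refl ℂ E') Ξ - d‖ ≤ 3 * ε := by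
  obtain ⟨Ξ₀, hΞ₀⟩ : ∃ z : E ⊗[ℂ] E', ‖Ξ - (z : Completion (E ⊗[ℂ] E'))‖ < ε := by
    obtain ⟨z, hz⟩ := (Completion.denseRange_coe (α := E ⊗[ℂ] E')).exists_dist_lt Ξ hε
    exact ⟨z, by rwa [dist_eq_norm] at hz⟩
  obtain ⟨A, B, hA, hB, hAB⟩ := TensorProduct.exists_finite_submodule_of_setFinite {Ξ₀}
    (Set.finite_singleton Ξ₀)
  obtain ⟨z, rfl⟩ := hAB rfl
  clear hAB
  have : FiniteDimensional ℂ A := hA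
  have : FiniteDimensional ℂ B := hB
  let j : A ⊗[ℂ] B →ₗ[ℂ] Completion (E ⊗[ℂ] E') :=
    (Completion.toComplₗᵢ (𝕜 := ℂ) (E := E ⊗[ℂ] E')).toLinearMap ∘ₗ TensorProduct.mapIncl A B
  refine ⟨LinearMap.range j, inferInstance, fun f f' hfix => ?_⟩
  -- `(f ⊗ 1) Ξ` is approximated by `z₁ = (f ⊗ 1) Ξ₀` in `E ⊗ B` and by `z₂ = (1 ⊗ f'⁻¹) Ξ₀` in `A ⊗
  -- E'`. Applying `Q ⊗ 1` fixes `z₂` and sends `z₁` into `A ⊗ B`; this costs `2ε`, on top of the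
  -- `ε` of the approximation.
  let Q : E →L[ℂ] E := A.starProjection
  have hQ₂ : Q.rTensor E' (TensorProduct.congrIsometry (.refl ℂ E) f'.symm
      (TensorProduct.mapIncl A B z)) =
      TensorProduct.congrIsometry (.refl ℂ E) f'.symm (TensorProduct.mapIncl A B z) := by
    clear hΞ₀
    induction z with
    | zero => simp only [map_zero]
    | tmul a b =>
      change Q (a : E) ⊗ₜ[ℂ] f'.symm b = (a : E) ⊗ₜ[ℂ] f'.symm b
      rw [Submodule.starProjection_eq_self_iff.2 a.2]
    | add a b ha hb => simp only [map_add, ha, hb]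
  have hQ₁ : ∃ w : A ⊗[ℂ] B, Q.rTensor E' (TensorProduct.congrIsometry f (.refl ℂ E')
      (TensorProduct.mapIncl A B z)) = TensorProduct.mapIncl A B w := by
    clear hΞ₀ hQ₂
    induction z with
    | zero => exact ⟨0, by simp only [map_zero]⟩
    | tmul a b => exact ⟨(⟨Q (f a), A.starProjection_apply_mem _⟩ : A) ⊗ₜ[ℂ] b, rfl⟩
    | add a b ha hb =>
      obtain ⟨w₁, h₁⟩ := ha
      obtain ⟨w₂, h₂⟩ := hb
      exact ⟨w₁ + w₂, by simp only [map_add, h₁, h₂]⟩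
  obtain ⟨w, hw⟩ := hQ₁
  set Ξ₀ := TensorProduct.mapIncl A B z
  have hinv : hilbertTensor f (.refl ℂ E') Ξ = hilbertTensor (.refl ℂ E) f'.symm Ξ := by
    have h := hilbertTensor_mul (f₁ := .refl ℂ E) (f₂ := f) (f₃ := f)
      (g₁ := f'.symm) (g₂ := f') (g₃ := .refl ℂ E') (c := 1) (d := 1)
      (fun x => by simp) (fun y => by simp) Ξ
    rw [hfix, mul_one, one_smul] at h
    exact h.symm
  set z₁ := TensorProduct.congrIsometry f (.refl ℂ E') Ξ₀ with hz₁
  set z₂ := TensorProduct.congrIsometry (.refl ℂ E) f'.symm Ξ₀ with hz₂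
  have h₁ : ‖hilbertTensor f (.refl ℂ E') Ξ - (z₁ : Completion (E ⊗[ℂ] E'))‖ < ε := by
    rw [hz₁, ← hilbertTensor_coe, ← map_sub, LinearIsometryEquiv.norm_map]
    exact hΞ₀
  have h₂ : ‖hilbertTensor f (.refl ℂ E') Ξ - (z₂ : Completion (E ⊗[ℂ] E'))‖ < ε := by
    rw [hinv, hz₂, ← hilbertTensor_coe, ← map_sub, LinearIsometryEquiv.norm_map]
    exact hΞ₀
  have h₁₂ : ‖z₂ - z₁‖ ≤ 2 * ε := by
    rw [← Completion.norm_coe, Completion.coe_sub,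
      ← sub_sub_sub_cancel_left _ _ (hilbertTensor f (.refl ℂ E') Ξ)]
    exact (norm_sub_le _ _).trans (by linarith)
  refine ⟨j w, ⟨w, rfl⟩, ?_⟩
  change ‖_ - ((TensorProduct.mapIncl A B w : E ⊗[ℂ] E') : Completion (E ⊗[ℂ] E'))‖ ≤ _
  rw [← hw]
  have h₃ : ‖z₂ - Q.rTensor E' z₁‖ ≤ 2 * ε := by
    nth_rewrite 1 [← hQ₂]
    rw [← map_sub]
    refine ((Q.rTensor E').le_opNorm _).trans ?_
    have h4 : ‖Q.rTensor E'‖ ≤ 1 :=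
      (ContinuousLinearMap.norm_rTensor_le E' Q).trans A.starProjection_norm_le
    nlinarith [norm_nonneg (z₂ - z₁)]
  have h₄ : hilbertTensor f (.refl ℂ E') Ξ - ((Q.rTensor E' z₁ : E ⊗[ℂ] E') : Completion (E ⊗[ℂ] E')) =
      (hilbertTensor f (.refl ℂ E') Ξ - (z₂ : Completion (E ⊗[ℂ] E'))) +
        ((z₂ - Q.rTensor E' z₁ : E ⊗[ℂ] E') : Completion (E ⊗[ℂ] E')) := by
    rw [Completion.coe_sub]; abel
  rw [h₄]
  refine (norm_add_le _ _).trans ?_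
  rw [Completion.norm_coe]
  linarith

/-- If `x` and `y` are unitaries that commute up to the scalar `ω`, and for some unitaries `x'`, `y'`
both `x ⊗ x'` and `y ⊗ y'` fix a non-zero vector, then `ω` is a root of unity. -/
theorem isOfFinOrder_of_hilbertTensor_fixed {x y : E ≃ₗᵢ[ℂ] E} {x' y' : E' ≃ₗᵢ[ℂ] E'} {ω : Circle}
    (hxy : ∀ v, x (y v) = (ω : ℂ) • y (x v)) {Ξ : Completion (E ⊗[ℂ] E')} (hΞ : Ξ ≠ 0)
    (hx : hilbertTensor x x' Ξ = Ξ) (hy : hilbertTensor y y' Ξ = Ξ) : IsOfFinOrder ω := by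
  by_contra hω
  wlog hn : ‖Ξ‖ = 1 generalizing Ξ
  · have h0 : ‖Ξ‖ ≠ 0 := norm_ne_zero_iff.2 hΞ
    refine this (Ξ := ((‖Ξ‖⁻¹ : ℝ) : ℂ) • Ξ) ?_ ?_ ?_ ?_
    · exact smul_ne_zero (by exact_mod_cast inv_ne_zero h0) hΞ
    · rw [map_smul, hx]
    · rw [map_smul, hy]
    · rw [norm_smul, Complex.norm_real, norm_inv, norm_norm, inv_mul_cancel₀ h0]
  have hyk : ∀ k : ℕ, hilbertTensor (y ^ k) (y' ^ k) Ξ = Ξ := fun k => by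
    induction k with
    | zero => exact hilbertTensor_one Ξ
    | succ k ih =>
      have h := hilbertTensor_mul (f₁ := y) (f₂ := y ^ k) (f₃ := y ^ (k + 1))
        (g₁ := y') (g₂ := y' ^ k) (g₃ := y' ^ (k + 1)) (c := 1) (d := 1)
        (fun x => by simp [pow_succ']) (fun y => by simp [pow_succ']) Ξ
      rw [ih, hy, mul_one, one_smul] at h
      exact h.symm
  have hxyk : ∀ (k : ℕ) v, x ((y ^ k) v) = (ω : ℂ) ^ k • (y ^ k) (x v) := fun k => by
    induction k with
    | zero => simp
    | succ k ih =>
      intro v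
      rw [pow_succ', LinearIsometryEquiv.coe_mul, Function.comp_apply, hxy, ih, map_smul,
        smul_smul, ← pow_succ']
      rfl
  -- Moving only the first leg makes these eigenvectors of `x ⊗ x'` with eigenvalues `ω ^ k`, which
  -- are pairwise distinct when `ω` has infinite order.
  let X : ℕ → Completion (E ⊗[ℂ] E') := fun k => hilbertTensor (y ^ k) (.refl ℂ E') Ξ
  have hX : ∀ k, hilbertTensor x x' (X k) = (ω : ℂ) ^ k • X k := fun k => by
    have h := hilbertTensor_intertwine (f₁ := x) (f₂ := y ^ k) (f₃ := y ^ k) (f₄ := x)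
      (g₁ := x') (g₂ := .refl ℂ E') (g₃ := .refl ℂ E') (g₄ := x') (c := (ω : ℂ) ^ k) (d := 1)
      (hxyk k) (fun y => by simp) Ξ
    rw [hx, mul_one] at h
    exact h
  have ho : Orthonormal ℂ X := by
    refine ⟨fun k => by rw [LinearIsometryEquiv.norm_map, hn], fun k l hkl => ?_⟩
    have h := (hilbertTensor x x').inner_map_map (X k) (X l)
    rw [hX, hX, inner_smul_left, inner_smul_right, ← mul_assoc] at h
    by_contra h0
    have h1 := mul_right_cancel₀ h0 (h.trans (one_mul _).symm)
    rw [map_pow, ← Circle.coe_inv_eq_conj] at h1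
    have h2 : ω⁻¹ ^ k * ω ^ l = 1 := by
      apply Circle.coe_injective
      push_cast
      exact_mod_cast h1
    rw [inv_pow, inv_mul_eq_one] at h2
    exact hkl (injective_pow_iff_not_isOfFinOrder.2 hω h2)
  obtain ⟨D, hD, hnear⟩ := exists_finiteDimensional_near Ξ (show (0 : ℝ) < 1 / 12 by norm_num)
  choose d hd hXd using fun k => hnear (y ^ k) (y' ^ k) (hyk k)
  exact ho.not_near_finiteDimensional D hd fun k => (hXd k).trans (by norm_num)

end TensorCompletion

/-! ### Property (T) for projective representations -/

/-- A relative property (T) for pairs of projective representations with opposite cocycles. -/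
theorem HasRelativePropertyT.exists_hilbertTensor_fixed {G : Type} [Group G] [Countable G]
    {H : Subgroup G} (hT : HasRelativePropertyT H) : ∃ ε : ℝ, 0 < ε ∧ ∃ F : Finset G,
    ∀ (E E' : Type u) [NormedAddCommGroup E] [InnerProductSpace ℂ E]
      [NormedAddCommGroup E'] [InnerProductSpace ℂ E'] (c : G → G → Circle)
      (π : G → E ≃ₗᵢ[ℂ] E) (π' : G → E' ≃ₗᵢ[ℂ] E'), π 1 = 1 → π' 1 = 1 →
      (∀ g h x, π g (π h x) = (c g h : ℂ) • π (g * h) x) →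
      (∀ g h x, π' g (π' h x) = ((c g h)⁻¹ : Circle) • π' (g * h) x) →
      ∀ (ζ : E) (ζ' : E'), ζ ≠ 0 → ζ' ≠ 0 →
      (∀ g ∈ F, ‖π g ζ - ζ‖ < ε * ‖ζ‖) → (∀ g ∈ F, ‖π' g ζ' - ζ'‖ < ε * ‖ζ'‖) →
      ∃ Ξ : Completion (E ⊗[ℂ] E'), Ξ ≠ 0 ∧ ∀ h ∈ H, hilbertTensor (π h) (π' h) Ξ = Ξ := by
  obtain ⟨δ, hδ, F, hF⟩ := hT.exists_fixed
  -- Half of `δ` for each tensor leg: the displacement of `ζ ⊗ ζ'` is at most the sum of the two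
  -- displacements. The opposite cocycles cancel, so the tensor product is a true representation.
  refine ⟨δ / 2, half_pos hδ, F, fun E E' _ _ _ _ c π π' hπ1 hπ1' hπ hπ' ζ ζ' hζ hζ' hi hi' => ?_⟩
  let ρ : G →* (Completion (E ⊗[ℂ] E') ≃ₗᵢ[ℂ] Completion (E ⊗[ℂ] E')) :=
    { toFun := fun g => hilbertTensor (π g) (π' g)
      map_one' := by
        ext z : 1
        rw [hπ1, hπ1']
        exact hilbertTensor_one z
      map_mul' := fun g h => by
        ext z : 1
        have h := hilbertTensor_mul (hπ g h) (hπ' g h) z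
        rw [← Circle.coe_mul, mul_inv_cancel, Circle.coe_one, one_smul] at h
        exact h.symm }
  have h0 : 0 < ‖ζ‖ * ‖ζ'‖ := mul_pos (norm_pos_iff.2 hζ) (norm_pos_iff.2 hζ')
  refine hF _ ρ (((‖ζ‖ * ‖ζ'‖ : ℝ) : ℂ)⁻¹ • ((ζ ⊗ₜ[ℂ] ζ' : E ⊗[ℂ] E') : Completion (E ⊗[ℂ] E')))
    ?_ fun g hg => ?_
  · rw [norm_smul, Completion.norm_coe, TensorProduct.norm_tmul, norm_inv, Complex.norm_real,
      Real.norm_of_nonneg h0.le, inv_mul_cancel₀ h0.ne']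
  · rw [map_smul, ← smul_sub, norm_smul, norm_inv, Complex.norm_real, Real.norm_of_nonneg h0.le,
      inv_mul_lt_iff₀ h0]
    change ‖hilbertTensor (π g) (π' g) _ - _‖ < _
    rw [hilbertTensor_tmul, ← Completion.coe_sub, Completion.norm_coe]
    have h1 : π g ζ ⊗ₜ[ℂ] π' g ζ' - ζ ⊗ₜ[ℂ] ζ' =
        (π g ζ - ζ) ⊗ₜ[ℂ] π' g ζ' + ζ ⊗ₜ[ℂ] (π' g ζ' - ζ') := by
      rw [TensorProduct.sub_tmul, TensorProduct.tmul_sub]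
      abel
    rw [h1]
    refine (norm_add_le _ _).trans_lt ?_
    rw [TensorProduct.norm_tmul, TensorProduct.norm_tmul, LinearIsometryEquiv.norm_map]
    have h2 := mul_lt_mul_of_pos_right (hi g hg) (norm_pos_iff.2 hζ')
    have h3 := mul_lt_mul_of_pos_left (hi' g hg) (norm_pos_iff.2 hζ)
    linarith

/-! ### Tracial `*`-algebras, their 2-norm and their corners -/

/-- A faithful positive tracial functional on a `*`-algebra. -/
structure FaithfulTrace (B : Type*) [Ring B] [StarRing B] [Algebra ℂ B] where
  toLinearMap : B →ₗ[ℂ] ℂ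
  trace : ∀ x y, toLinearMap (x * y) = toLinearMap (y * x)
  nonneg : ∀ x, 0 ≤ toLinearMap (star x * x)
  faithful : ∀ x, toLinearMap (star x * x) = 0 → x = 0

namespace FaithfulTrace

variable {B : Type*} [Ring B] [StarRing B] [Algebra ℂ B] [StarModule ℂ B]

/-- Polarization: positivity makes `τ (z* z)` real, and `z = x + y` and `z = x + i y` give the real
and imaginary parts of hermitian symmetry. -/
theorem conj_apply (τ : FaithfulTrace B) (x y : B) :
    (starRingEnd ℂ) (τ.toLinearMap (star y * x)) = τ.toLinearMap (star x * y) := by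
  have him : ∀ z, (τ.toLinearMap (star z * z)).im = 0 := fun z =>
    ((Complex.le_def.1 (τ.nonneg z)).2).symm
  have h1 := him (x + y)
  have h2 := him (x + Complex.I • y)
  have hx := him x
  have hy := him y
  simp only [star_add, star_smul, add_mul, mul_add, map_add, smul_mul_assoc, mul_smul_comm,
    map_smul, Complex.add_im, hx, hy, smul_eq_mul, Complex.mul_im, Complex.I_re,
    Complex.I_im, RCLike.star_def, Complex.conj_I, Complex.neg_re, Complex.neg_im,
    Complex.mul_re] at h1 h2
  apply Complex.ext
  · simp only [Complex.conj_re]; linarith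
  · simp only [Complex.conj_im]; linarith

/-- The `*`-algebra `B` with the inner product `⟪x, y⟫ = τ (x* y)`. -/
def L2 (_ : FaithfulTrace B) : Type _ := B

variable (τ : FaithfulTrace B)

instance : AddCommGroup τ.L2 := inferInstanceAs (AddCommGroup B)
instance : Module ℂ τ.L2 := inferInstanceAs (Module ℂ B)

/-- The identity map from `B` to `B` with its `2`-norm. -/
def toL2 : B ≃ₗ[ℂ] τ.L2 := LinearEquiv.refl ℂ B

/-- The inner product `τ (x* y)`. -/
@[reducible] noncomputable def core : InnerProductSpace.Core ℂ τ.L2 where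
  inner x y := τ.toLinearMap (star (τ.toL2.symm x) * τ.toL2.symm y)
  conj_inner_symm x y := τ.conj_apply _ _
  re_inner_nonneg x := (Complex.le_def.1 (τ.nonneg _)).1
  add_left x y z := by simp [add_mul]
  smul_left x y r := by simp [map_smul, star_smul]
  definite x hx := by
    have := τ.faithful _ hx
    simpa using this

noncomputable instance : NormedAddCommGroup τ.L2 := τ.core.toNormedAddCommGroup
noncomputable instance : InnerProductSpace ℂ τ.L2 := .ofCore τ.core.toCore

theorem inner_toL2 (x y : B) : ⟪τ.toL2 x, τ.toL2 y⟫_ℂ = τ.toLinearMap (star x * y) := rfl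

theorem norm_toL2_sq (x : B) : ‖τ.toL2 x‖ ^ 2 = (τ.toLinearMap (star x * x)).re := by
  rw [← inner_toL2, inner_self_eq_norm_sq_to_K]
  norm_cast

theorem norm_toL2_star (x : B) : ‖τ.toL2 (star x)‖ = ‖τ.toL2 x‖ := by
  rw [← sq_eq_sq₀ (norm_nonneg _) (norm_nonneg _), norm_toL2_sq, norm_toL2_sq, star_star, τ.trace]

theorem norm_toL2_mul_of_star_mul {a p x : B} (ha : star a * a = p) (hp : p * x = x) :
    ‖τ.toL2 (a * x)‖ = ‖τ.toL2 x‖ := by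
  rw [← sq_eq_sq₀ (norm_nonneg _) (norm_nonneg _), norm_toL2_sq, norm_toL2_sq, star_mul,
    mul_assoc, ← mul_assoc (star a), ha, hp]

/-- As `1 - a* a` is a projection, `‖x‖² - ‖a x‖²` is the squared 2-norm of `(1 - a* a) x`. No
operator norm on `B` is needed. -/
theorem norm_toL2_mul_le {a : B} (ha : IsStarProjection (star a * a)) (x : B) :
    ‖τ.toL2 (a * x)‖ ≤ ‖τ.toL2 x‖ := by
  have h2 : star (star a * a) = star a * a := ha.isSelfAdjoint
  have h3 : (star a * a) * (star a * a) = star a * a := ha.isIdempotentElem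
  rw [← sq_le_sq₀ (norm_nonneg _) (norm_nonneg _), norm_toL2_sq, norm_toL2_sq]
  have h1 := (Complex.le_def.1 (τ.nonneg ((1 - star a * a) * x))).1
  have h4 : star ((1 - star a * a) * x) * ((1 - star a * a) * x) =
      star x * x - star (a * x) * (a * x) := by
    have h5 : (1 - star a * a) * (1 - star a * a) = 1 - star a * a := by
      rw [mul_sub, mul_one, sub_mul, one_mul, h3, sub_self, sub_zero]
    rw [star_mul, star_sub, star_one, h2, mul_assoc, ← mul_assoc _ _ x, h5, star_mul]
    noncomm_ring
  rw [h4, map_sub, Complex.sub_re] at h1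
  simpa using h1

/-- The subspace `p B q` of `L²`. -/
def corner (p q : B) : Submodule ℂ τ.L2 where
  carrier := {x | p * τ.toL2.symm x = τ.toL2.symm x ∧ τ.toL2.symm x * q = τ.toL2.symm x}
  add_mem' := fun {a b} ha hb => by
    simp only [Set.mem_ofPred_eq, map_add, mul_add, add_mul] at *
    rw [ha.1, hb.1, ha.2, hb.2]; simp
  zero_mem' := by simp
  smul_mem' := fun c x hx => by
    simp only [Set.mem_ofPred_eq, map_smul, mul_smul_comm, smul_mul_assoc] at *
    rw [hx.1, hx.2]; simp

/-- The map `x ↦ u x v*` on `p B q` for partial isometries `u` and `v` of support and range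
`p` and `q`. -/
noncomputable def cornerConj {p q u v : B} (hu : star u * u = p) (hu' : u * star u = p)
    (hv : star v * v = q) (hv' : v * star v = q) : τ.corner p q ≃ₗᵢ[ℂ] τ.corner p q where
  toFun x := ⟨τ.toL2 (u * τ.toL2.symm x * star v), by
    have h1 : p * u = u * p := by rw [← hu, ← mul_assoc, hu', hu]
    have h2 : star v * q = q * star v := by rw [← hv', ← mul_assoc, hv, hv']
    refine ⟨?_, ?_⟩
    · simp only [LinearEquiv.symm_apply_apply, ← mul_assoc]
      rw [h1, mul_assoc u, x.2.1]
    · simp only [LinearEquiv.symm_apply_apply, mul_assoc]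
      rw [h2, ← mul_assoc _ q, x.2.2]⟩
  invFun x := ⟨τ.toL2 (star u * τ.toL2.symm x * v), by
    have h1 : p * star u = star u * p := by rw [← hu', ← mul_assoc, hu, hu']
    have h2 : v * q = q * v := by rw [← hv, ← mul_assoc, hv', hv]
    refine ⟨?_, ?_⟩
    · simp only [LinearEquiv.symm_apply_apply, ← mul_assoc]
      rw [h1, mul_assoc (star u), x.2.1]
    · simp only [LinearEquiv.symm_apply_apply, mul_assoc]
      rw [h2, ← mul_assoc _ q, x.2.2]⟩
  map_add' x y := by ext; simp [mul_add, add_mul]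
  map_smul' c x := by ext; simp
  left_inv x := by
    ext
    simp only [LinearEquiv.symm_apply_apply]
    rw [mul_assoc u, ← mul_assoc (star u), hu, mul_assoc p, mul_assoc _ (star v) v, hv, x.2.2,
      x.2.1]
    simp
  right_inv x := by
    ext
    simp only [LinearEquiv.symm_apply_apply]
    rw [mul_assoc (star u), ← mul_assoc u, hu', mul_assoc p, mul_assoc _ v, hv', x.2.2, x.2.1]
    simp
  norm_map' x := by
    change ‖τ.toL2 (u * τ.toL2.symm x * star v)‖ = ‖(x : τ.L2)‖
    rw [mul_assoc, τ.norm_toL2_mul_of_star_mul hu (by rw [← mul_assoc, x.2.1]), ← norm_toL2_star,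
      star_mul, star_star, τ.norm_toL2_mul_of_star_mul hv, norm_toL2_star]
    · simp
    · have hq : star q = q := by rw [← hv, star_mul, star_star]
      have h := congrArg star x.2.2
      rwa [star_mul, hq] at h

end FaithfulTrace

/-! ### Projective representations and their rigidity -/

/-- A circle-valued 2-cocycle is normalized if it is trivial on `(1, g)`, `(g, 1)` and
`(g, g⁻¹)`. -/
structure IsNormalizedCocycle {G : Type*} [Group G] (μ : G → G → Circle) : Prop where
  one_left : ∀ g, μ 1 g = 1
  one_right : ∀ g, μ g 1 = 1
  mul_inv : ∀ g, μ g g⁻¹ = 1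
  cocycle : ∀ g h k, μ g h * μ (g * h) k = μ g (h * k) * μ h k

/-- A projective representation of `G` with cocycle `μ` in a `*`-algebra; it need not be unital. -/
structure IsProjectiveRep {G B : Type*} [Group G] [Ring B] [StarRing B] [Algebra ℂ B]
    (μ : G → G → Circle) (u : G → B) : Prop where
  mul : ∀ g h, u g * u h = (μ g h : ℂ) • u (g * h)
  star : ∀ g, star (u g) = u g⁻¹

namespace IsProjectiveRep

variable {G B : Type*} [Group G] [Ring B] [StarRing B] [Algebra ℂ B]
  {μ : G → G → Circle} {u : G → B}

theorem one_mul (hu : IsProjectiveRep μ u) (hμ : IsNormalizedCocycle μ) (g : G) :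
    u 1 * u g = u g := by
  rw [hu.mul, hμ.one_left, Circle.coe_one, one_smul, _root_.one_mul]

theorem mul_one (hu : IsProjectiveRep μ u) (hμ : IsNormalizedCocycle μ) (g : G) :
    u g * u 1 = u g := by
  rw [hu.mul, hμ.one_right, Circle.coe_one, one_smul, _root_.mul_one]

theorem star_one (hu : IsProjectiveRep μ u) : Star.star (u 1) = u 1 := by
  rw [hu.star, inv_one]

theorem mul_star (hu : IsProjectiveRep μ u) (hμ : IsNormalizedCocycle μ) (g : G) :
    u g * Star.star (u g) = u 1 := by
  rw [hu.star, hu.mul, hμ.mul_inv, Circle.coe_one, one_smul, mul_inv_cancel]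

theorem star_mul (hu : IsProjectiveRep μ u) (hμ : IsNormalizedCocycle μ) (g : G) :
    Star.star (u g) * u g = u 1 := by
  have h := hu.mul_star hμ g⁻¹
  rwa [hu.star g⁻¹, inv_inv, ← hu.star] at h

theorem isStarProjection (hu : IsProjectiveRep μ u) (hμ : IsNormalizedCocycle μ) :
    IsStarProjection (u 1) :=
  ⟨hu.one_mul hμ 1, hu.star_one⟩

end IsProjectiveRep

namespace FaithfulTrace

variable {G B : Type*} [Group G] [Ring B] [StarRing B] [Algebra ℂ B] [StarModule ℂ B]
  (τ : FaithfulTrace B) {μ ν : G → G → Circle} {u v : G → B}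

/-- The projective representation `x ↦ u g x (v g)*` on the corner `u 1 B v 1`. -/
noncomputable def cornerRep (hμ : IsNormalizedCocycle μ) (hν : IsNormalizedCocycle ν)
    (hu : IsProjectiveRep μ u) (hv : IsProjectiveRep ν v) (g : G) :
    τ.corner (u 1) (v 1) ≃ₗᵢ[ℂ] τ.corner (u 1) (v 1) :=
  τ.cornerConj (hu.star_mul hμ g) (hu.mul_star hμ g) (hv.star_mul hν g) (hv.mul_star hν g)

theorem coe_cornerRep (hμ : IsNormalizedCocycle μ) (hν : IsNormalizedCocycle ν)
    (hu : IsProjectiveRep μ u) (hv : IsProjectiveRep ν v) (g : G) (x : τ.corner (u 1) (v 1)) :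
    (τ.cornerRep hμ hν hu hv g x : τ.L2) =
      τ.toL2 (u g * τ.toL2.symm x * star (v g)) := rfl

theorem cornerRep_one (hμ : IsNormalizedCocycle μ) (hν : IsNormalizedCocycle ν)
    (hu : IsProjectiveRep μ u) (hv : IsProjectiveRep ν v) : τ.cornerRep hμ hν hu hv 1 = 1 := by
  ext x
  rw [coe_cornerRep, x.2.1, hv.star_one, x.2.2]
  simp

/-- The adjoint on the right conjugates the scalar of `v`, so the cocycle is the quotient of the
two; exchanging `u` and `v` inverts it. -/
theorem cornerRep_mul (hμ : IsNormalizedCocycle μ) (hν : IsNormalizedCocycle ν)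
    (hu : IsProjectiveRep μ u) (hv : IsProjectiveRep ν v) (g h : G)
    (x : τ.corner (u 1) (v 1)) :
    τ.cornerRep hμ hν hu hv g (τ.cornerRep hμ hν hu hv h x) =
      ((μ g h * (ν g h)⁻¹ : Circle) : ℂ) • τ.cornerRep hμ hν hu hv (g * h) x := by
  ext
  rw [Submodule.coe_smul, coe_cornerRep, coe_cornerRep, coe_cornerRep, LinearEquiv.symm_apply_apply,
    ← map_smul]
  have h1 : star (v h) * star (v g) = (((ν g h)⁻¹ : Circle) : ℂ) • star (v (g * h)) := by
    rw [← star_mul, hv.mul, star_smul, Circle.coe_inv_eq_conj]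
    rfl
  have h2 : u g * (u h * τ.toL2.symm (x : τ.L2) * star (v h)) * star (v g) =
      (u g * u h) * τ.toL2.symm (x : τ.L2) * (star (v h) * star (v g)) := by
    noncomm_ring
  rw [h2, h1, hu.mul, smul_mul_assoc, smul_mul_assoc, mul_smul_comm, smul_smul, Circle.coe_mul]

theorem mul_mem_corner (hμ : IsNormalizedCocycle μ) (hν : IsNormalizedCocycle ν)
    (hu : IsProjectiveRep μ u) (hv : IsProjectiveRep ν v) :
    τ.toL2 (u 1 * v 1) ∈ τ.corner (u 1) (v 1) := by
  refine ⟨?_, ?_⟩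
  · rw [LinearEquiv.symm_apply_apply, ← mul_assoc, hu.one_mul hμ]
  · rw [LinearEquiv.symm_apply_apply, mul_assoc, hv.one_mul hν]

/-- With `p = u 1` and `q = v 1`, the displacement of `pq` is `u g (v g - u g)* + p (p - q)`. Left
multiplication by the partial isometries `u g` and `p` contracts the 2-norm, and the adjoint
preserves it. -/
theorem norm_cornerRep_sub_le (hμ : IsNormalizedCocycle μ) (hν : IsNormalizedCocycle ν)
    (hu : IsProjectiveRep μ u) (hv : IsProjectiveRep ν v) (g : G) :
    ‖τ.cornerRep hμ hν hu hv g ⟨_, τ.mul_mem_corner hμ hν hu hv⟩ -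
        ⟨_, τ.mul_mem_corner hμ hν hu hv⟩‖ ≤
      ‖τ.toL2 (u g - v g)‖ + ‖τ.toL2 (u 1 - v 1)‖ := by
  change ‖τ.toL2 (u g * τ.toL2.symm (τ.toL2 (u 1 * v 1)) * star (v g)) - τ.toL2 (u 1 * v 1)‖ ≤ _
  have h1 : u g * (u 1 * v 1) * star (v g) - u 1 * v 1 =
      u g * star (v g - u g) + u 1 * (u 1 - v 1) := by
    rw [← mul_assoc, hu.mul_one hμ, mul_assoc, star_sub, mul_sub, mul_sub, hu.mul_star hμ,
      hu.one_mul hμ, hv.star, hv.one_mul hν]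
    abel
  rw [LinearEquiv.symm_apply_apply, ← map_sub, h1, map_add]
  refine (norm_add_le _ _).trans (add_le_add ?_ ?_)
  · refine (τ.norm_toL2_mul_le ?_ _).trans ?_
    · rw [hu.star_mul hμ]; exact hu.isStarProjection hμ
    · rw [norm_toL2_star, ← neg_sub, map_neg, norm_neg]
  · refine τ.norm_toL2_mul_le ?_ _
    rw [hu.star_mul hμ]; exact hu.isStarProjection hμ

/-- Splitting `p = pq + p (p - q)` keeps the candidate vector `pq` away from zero when the two units
are close. -/
theorem norm_sub_le_norm_mul (hμ : IsNormalizedCocycle μ) (hu : IsProjectiveRep μ u) :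
    ‖τ.toL2 (u 1)‖ - ‖τ.toL2 (u 1 - v 1)‖ ≤ ‖τ.toL2 (u 1 * v 1)‖ := by
  have h1 : τ.toL2 (u 1) = τ.toL2 (u 1 * v 1) + τ.toL2 (u 1 * (u 1 - v 1)) := by
    rw [← map_add, mul_sub, hu.one_mul hμ]
    congr 1
    abel
  have h2 : ‖τ.toL2 (u 1 * (u 1 - v 1))‖ ≤ ‖τ.toL2 (u 1 - v 1)‖ := by
    refine τ.norm_toL2_mul_le ?_ _
    rw [hu.star_mul hμ]; exact hu.isStarProjection hμ
  have h3 := norm_add_le (τ.toL2 (u 1 * v 1)) (τ.toL2 (u 1 * (u 1 - v 1)))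
  rw [← h1] at h3
  linarith

end FaithfulTrace

/-- Projective representations of `G`, with the relative property (T) of `H ⊂ G`, that are close on
a finite set in the `2`-norm of a tracial `*`-algebra have cocycles that agree on `H` up to torsion:
their commutation factors differ by a root of unity. -/
theorem HasRelativePropertyT.exists_rigidity {G : Type} [Group G] [Countable G]
    {H : Subgroup G} (hT : HasRelativePropertyT H) : ∃ F : Finset G, ∀ t : ℝ, 0 < t →
    ∃ ε : ℝ, 0 < ε ∧ ∀ (B : Type u) [Ring B] [StarRing B] [Algebra ℂ B] [StarModule ℂ B]
      (τ : FaithfulTrace B) (μ ν : G → G → Circle) (u v : G → B),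
      IsNormalizedCocycle μ → IsNormalizedCocycle ν → IsProjectiveRep μ u → IsProjectiveRep ν v →
      t ≤ ‖τ.toL2 (u 1)‖ → (∀ g ∈ F, ‖τ.toL2 (u g - v g)‖ < ε) →
      ∀ x ∈ H, ∀ y ∈ H, x * y = y * x →
        IsOfFinOrder ((μ x y * (ν x y)⁻¹) * (μ y x * (ν y x)⁻¹)⁻¹) := by
  classical
  obtain ⟨δ, hδ, F, hF⟩ := hT.exists_hilbertTensor_fixed
  -- Closeness at `1` within `t / 2` gives `‖pq‖ ≥ t / 2`; closeness within `δ t / 4` at `1` and at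
  -- `g` makes the displacement less than `δ t / 2 ≤ δ ‖pq‖`.
  refine ⟨insert 1 F, fun t ht => ⟨min (t / 2) (δ * t / 4), by positivity, ?_⟩⟩
  intro B _ _ _ _ τ μ ν u v hμ hν hu hv htu hclose x hx y hy hxy
  have h1 : ‖τ.toL2 (u 1 - v 1)‖ < min (t / 2) (δ * t / 4) := hclose 1 (Finset.mem_insert_self _ _)
  have hlow : t / 2 ≤ ‖τ.toL2 (u 1 * v 1)‖ := by
    have := τ.norm_sub_le_norm_mul (v := v) hμ hu
    linarith [h1.trans_le (min_le_left _ _)]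
  have hlow' : t / 2 ≤ ‖τ.toL2 (v 1 * u 1)‖ := by
    rw [← FaithfulTrace.norm_toL2_star, star_mul, hu.star_one, hv.star_one]
    exact hlow
  have hsymm : ∀ g, ‖τ.toL2 (v g - u g)‖ = ‖τ.toL2 (u g - v g)‖ := fun g => by
    rw [← neg_sub, map_neg, norm_neg]
  have hbound : ∀ g ∈ F, ‖τ.toL2 (u g - v g)‖ + ‖τ.toL2 (u 1 - v 1)‖ < δ * (t / 2) := by
    intro g hg
    have h2 := (hclose g (Finset.mem_insert_of_mem hg)).trans_le (min_le_right _ _)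
    linarith [h1.trans_le (min_le_right _ _)]
  obtain ⟨Ξ, hΞ, hfix⟩ := hF (τ.corner (u 1) (v 1)) (τ.corner (v 1) (u 1))
    (fun g h => μ g h * (ν g h)⁻¹) (τ.cornerRep hμ hν hu hv) (τ.cornerRep hν hμ hv hu)
    (τ.cornerRep_one hμ hν hu hv) (τ.cornerRep_one hν hμ hv hu) (τ.cornerRep_mul hμ hν hu hv)
    (fun g h x => by
      rw [τ.cornerRep_mul hν hμ hv hu, mul_inv, inv_inv, mul_comm]
      rfl)
    ⟨_, τ.mul_mem_corner hμ hν hu hv⟩ ⟨_, τ.mul_mem_corner hν hμ hv hu⟩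
    (fun h => by
      have h' : τ.toL2 (u 1 * v 1) = 0 := congrArg Subtype.val h
      rw [h', norm_zero] at hlow
      linarith)
    (fun h => by
      have h' : τ.toL2 (v 1 * u 1) = 0 := congrArg Subtype.val h
      rw [h', norm_zero] at hlow'
      linarith)
    (fun g hg => ((τ.norm_cornerRep_sub_le hμ hν hu hv g).trans_lt (hbound g hg)).trans_le
      (mul_le_mul_of_nonneg_left hlow hδ.le))
    (fun g hg => ((τ.norm_cornerRep_sub_le hν hμ hv hu g).trans_lt (by
      rw [hsymm, hsymm]; exact hbound g hg)).trans_le (mul_le_mul_of_nonneg_left hlow' hδ.le))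
  refine isOfFinOrder_of_hilbertTensor_fixed (fun w => ?_) hΞ (hfix x hx) (hfix y hy)
  rw [τ.cornerRep_mul hμ hν hu hv, τ.cornerRep_mul hμ hν hu hv, smul_smul, ← Circle.coe_mul, hxy,
    inv_mul_cancel_right]

/-! ### The symplectic form and the lattice cocycle -/

section Lattice

variable {n : ℕ}

theorem symplecticForm_eq_sum (x y : ZLattice n) :
    symplecticForm x y = ∑ i, (x (.inl i) * y (.inr i) - x (.inr i) * y (.inl i)) := by
  simp [symplecticForm, dotProduct, Matrix.mulVec, Fintype.sum_sum_type, Matrix.one_apply,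
    Finset.sum_sub_distrib, ← sub_eq_add_neg]

theorem symplecticForm_swap (x y : ZLattice n) : symplecticForm y x = -symplecticForm x y := by
  simp only [symplecticForm_eq_sum, ← Finset.sum_neg_distrib]
  exact Finset.sum_congr rfl fun i _ => by ring

theorem symplecticForm_self (x : ZLattice n) : symplecticForm x x = 0 := by
  have := symplecticForm_swap x x
  omega

theorem symplecticForm_add_left (x y z : ZLattice n) :
    symplecticForm (x + y) z = symplecticForm x z + symplecticForm y z := add_dotProduct _ _ _

theorem symplecticForm_add_right (x y z : ZLattice n) :
    symplecticForm x (y + z) = symplecticForm x y + symplecticForm x z := by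
  rw [symplecticForm, Matrix.mulVec_add, dotProduct_add]
  rfl

/-- The form's matrix is `-Matrix.J`, so this is the equation `Aᵗ J A = J` up to sign. It is what
makes the cocycle on the lattice extend to the semidirect product. -/
theorem symplecticForm_mulVec (A : Matrix.symplecticGroup (Fin n) ℤ) (x y : ZLattice n) :
    symplecticForm ((A : Matrix (Fin n ⊕ Fin n) (Fin n ⊕ Fin n) ℤ) *ᵥ x)
      ((A : Matrix (Fin n ⊕ Fin n) (Fin n ⊕ Fin n) ℤ) *ᵥ y) = symplecticForm x y := by
  have hJ : (Matrix.fromBlocks 0 1 (-1) 0 : Matrix (Fin n ⊕ Fin n) (Fin n ⊕ Fin n) ℤ) =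
      -Matrix.J (Fin n) ℤ := by
    rw [Matrix.J, Matrix.fromBlocks_neg]; simp
  have hA := SymplecticGroup.mem_iff'.1 A.2
  rw [symplecticForm, symplecticForm, hJ, ← Matrix.vecMul_transpose, Matrix.dotProduct_mulVec,
    Matrix.dotProduct_mulVec, Matrix.vecMul_vecMul, Matrix.dotProduct_mulVec, Matrix.vecMul_vecMul,
    ← mul_assoc, mul_neg, neg_mul, hA]

variable (Γ : Subgroup (Matrix.symplecticGroup (Fin n) ℤ)) (β : Circle)

theorem LatticeSemidirect.toAdd_left_mul (g h : LatticeSemidirect n Γ) :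
    Multiplicative.toAdd (g * h).left = Multiplicative.toAdd g.left +
      (g.right.1 : Matrix (Fin n ⊕ Fin n) (Fin n ⊕ Fin n) ℤ) *ᵥ Multiplicative.toAdd h.left := rfl

theorem LatticeSemidirect.mulVec_mul (g h : LatticeSemidirect n Γ) (x : ZLattice n) :
    ((g * h).right.1 : Matrix (Fin n ⊕ Fin n) (Fin n ⊕ Fin n) ℤ) *ᵥ x =
      (g.right.1 : Matrix (Fin n ⊕ Fin n) (Fin n ⊕ Fin n) ℤ) *ᵥ
        ((h.right.1 : Matrix (Fin n ⊕ Fin n) (Fin n ⊕ Fin n) ℤ) *ᵥ x) := by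
  rw [Matrix.mulVec_mulVec]
  rfl

/-- The cocycle identity is bilinearity plus invariance of the form under `Γ`. Triviality on `(g,
g⁻¹)` holds because the form is alternating: the second argument becomes minus the first. -/
theorem latticeCocycle_isNormalized : IsNormalizedCocycle (latticeCocycle Γ β) where
  one_left g := by simp [latticeCocycle, symplecticForm]
  one_right g := by simp [latticeCocycle, symplecticForm]
  mul_inv g := by
    have h := LatticeSemidirect.toAdd_left_mul Γ g g⁻¹
    rw [mul_inv_cancel] at h
    have h' : (g.right.1 : Matrix (Fin n ⊕ Fin n) (Fin n ⊕ Fin n) ℤ) *ᵥ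
        Multiplicative.toAdd (g⁻¹).left = -Multiplicative.toAdd g.left :=
      (neg_eq_of_add_eq_zero_right h.symm).symm
    have h0 : symplecticForm (Multiplicative.toAdd g.left) (-Multiplicative.toAdd g.left) = 0 := by
      rw [symplecticForm, Matrix.mulVec_neg, dotProduct_neg, neg_eq_zero]
      exact symplecticForm_self _
    rw [latticeCocycle, h', h0, zpow_zero]
  cocycle g h k := by
    simp only [latticeCocycle, ← zpow_add]
    congr 1
    rw [LatticeSemidirect.toAdd_left_mul, LatticeSemidirect.toAdd_left_mul,
      LatticeSemidirect.mulVec_mul, Matrix.mulVec_add, symplecticForm_add_left,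
      symplecticForm_add_right, symplecticForm_mulVec]
    ring

theorem latticeCocycle_inl (x y : ZLattice n) :
    latticeCocycle Γ β (SemidirectProduct.inl (Multiplicative.ofAdd x))
      (SemidirectProduct.inl (Multiplicative.ofAdd y)) = β ^ symplecticForm x y := by
  simp [latticeCocycle]

instance : Countable (LatticeSemidirect n Γ) := by
  have : Countable (Matrix.symplecticGroup (Fin n) ℤ) :=
    have : Countable (Matrix (Fin n ⊕ Fin n) (Fin n ⊕ Fin n) ℤ) :=
      inferInstanceAs (Countable (Fin n ⊕ Fin n → Fin n ⊕ Fin n → ℤ))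
    Subtype.countable
  have : Countable (Multiplicative (ZLattice n)) := inferInstanceAs (Countable (Fin n ⊕ Fin n → ℤ))
  exact (SemidirectProduct.equivProd).injective.countable

end Lattice

/-! ### Countability tools and traces on matrices -/

theorem Circle.countable_isOfFinOrder : {z : Circle | IsOfFinOrder z}.Countable := by
  have h : {z : Circle | IsOfFinOrder z} ⊆ ⋃ k : ℕ, ((↑) : Circle → ℂ) ⁻¹' {w | w ^ (k + 1) = 1} := by
    intro z hz
    obtain ⟨k, hk, hz⟩ := isOfFinOrder_iff_pow_eq_one.1 hz
    refine Set.mem_iUnion.2 ⟨k - 1, ?_⟩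
    change (z : ℂ) ^ (k - 1 + 1) = 1
    rw [Nat.sub_add_cancel hk, ← Circle.coe_pow, hz, Circle.coe_one]
  refine (Set.countable_iUnion fun k => Set.Countable.preimage_of_injOn ?_
    Circle.coe_injective.injOn).mono h
  have : {w : ℂ | w ^ (k + 1) = 1} = (Polynomial.nthRootsFinset (k + 1) (1 : ℂ) : Set ℂ) := by
    ext w
    simp
  rw [this]
  exact Finset.countable_toSet _

/-- A set is countable if any two of its points with close images in a separable space are related,
and every point is related to countably many others. -/
theorem Set.Countable.of_close {I Y : Type*} [PseudoMetricSpace Y]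
    [TopologicalSpace.SeparableSpace Y] {S : Set I} (Θ : I → Y) {δ : ℝ} (hδ : 0 < δ)
    (R : I → I → Prop) (hclose : ∀ a ∈ S, ∀ b ∈ S, dist (Θ a) (Θ b) < δ → R a b)
    (hR : ∀ a, {b | R a b}.Countable) : S.Countable := by
  obtain ⟨D, hD, hdense⟩ := TopologicalSpace.exists_countable_dense Y
  have h : S ⊆ ⋃ y ∈ D, {b ∈ S | dist (Θ b) y < δ / 2} := fun b hb => by
    obtain ⟨y, hy, hby⟩ := hdense.exists_dist_lt (Θ b) (half_pos hδ)
    exact Set.mem_biUnion hy ⟨hb, hby⟩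
  refine (hD.biUnion fun y _ => ?_).mono h
  rcases Set.eq_empty_or_nonempty {b ∈ S | dist (Θ b) y < δ / 2} with h0 | ⟨a, ha, hay⟩
  · rw [h0]; exact Set.countable_empty
  · refine (hR a).mono fun b hb => hclose a ha b hb.1 ?_
    exact (dist_triangle_right _ _ y).trans_lt (by linarith [hb.2])

/-- The trace `∑ τ (x i i)` on matrices. -/
noncomputable def FaithfulTrace.matrix {B : Type*} [Ring B] [StarRing B] [Algebra ℂ B]
    (τ : FaithfulTrace B) (ι : Type*) [Fintype ι] [DecidableEq ι] :
    FaithfulTrace (Matrix ι ι B) where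
  toLinearMap := τ.toLinearMap ∘ₗ Matrix.traceLinearMap ι ℂ B
  trace x y := by
    simp only [LinearMap.comp_apply, Matrix.traceLinearMap_apply, Matrix.trace, Matrix.diag_apply,
      Matrix.mul_apply, map_sum]
    rw [Finset.sum_comm]
    exact Finset.sum_congr rfl fun i _ => Finset.sum_congr rfl fun j _ => τ.trace _ _
  nonneg x := by
    simp only [LinearMap.comp_apply, Matrix.traceLinearMap_apply, Matrix.trace, Matrix.diag_apply,
      Matrix.mul_apply, map_sum, Matrix.star_apply]
    exact Finset.sum_nonneg fun i _ => Finset.sum_nonneg fun j _ => τ.nonneg _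
  faithful x hx := by
    simp only [LinearMap.comp_apply, Matrix.traceLinearMap_apply, Matrix.trace, Matrix.diag_apply,
      Matrix.mul_apply, map_sum, Matrix.star_apply] at hx
    rw [Finset.sum_eq_zero_iff_of_nonneg
      fun i _ => Finset.sum_nonneg fun j _ => τ.nonneg _] at hx
    ext i j
    have h := (Finset.sum_eq_zero_iff_of_nonneg fun j _ => τ.nonneg _).1
      (hx j (Finset.mem_univ _)) i (Finset.mem_univ _)
    exact τ.faithful _ h

theorem FaithfulTrace.norm_matrix_sq {B : Type*} [Ring B] [StarRing B] [Algebra ℂ B]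
    [StarModule ℂ B] (τ : FaithfulTrace B) {ι : Type*} [Fintype ι] [DecidableEq ι]
    (x : Matrix ι ι B) : ‖(τ.matrix ι).toL2 x‖ ^ 2 = ∑ i, ∑ j, ‖τ.toL2 (x i j)‖ ^ 2 := by
  rw [norm_toL2_sq, Finset.sum_comm]
  simp only [FaithfulTrace.matrix, LinearMap.comp_apply, Matrix.traceLinearMap_apply, Matrix.trace,
    Matrix.diag_apply, Matrix.mul_apply, map_sum, Matrix.star_apply, Complex.re_sum, norm_toL2_sq]

/-! ### The separability argument -/

section Separability

variable {H : Type*} [NormedAddCommGroup H] [InnerProductSpace ℂ H] [CompleteSpace H]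

/-- The faithful trace of a finite von Neumann algebra. -/
def IsFaithfulNormalTrace.toFaithfulTrace {M : VonNeumannAlgebra H}
    {τ : M.toStarSubalgebra →ₗ[ℂ] ℂ} (hτ : IsFaithfulNormalTrace τ) :
    FaithfulTrace M.toStarSubalgebra where
  toLinearMap := τ
  trace := hτ.trace
  nonneg := hτ.nonneg
  faithful := hτ.faithful

/-- The bound `‖x‖ ≤ C` makes the tail uniformly small, and only finitely many vectors are left to
test. For a normal trace the series is `τ (x* x)`, whence the `ε ^ 2`. -/
theorem exists_control_tsum_inner {H : Type*} [NormedAddCommGroup H] [InnerProductSpace ℂ H] {ξ η : ℕ → H} (hξ : Summable fun i => ‖ξ i‖ ^ 2)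
    (hη : Summable fun i => ‖η i‖ ^ 2) (C : ℝ) {ε : ℝ} (hε : 0 < ε) :
    ∃ (N : ℕ) (δ : ℝ), 0 < δ ∧ ∀ x : H →L[ℂ] H, ‖x‖ ≤ C →
      (∀ i < N, ‖x (ξ i)‖ < δ) → (∀ i < N, ‖x (η i)‖ < δ) →
      ‖∑' i, ⟪x (η i), x (ξ i)⟫_ℂ‖ < ε ^ 2 := by
  have hs := (hξ.add hη).mul_left (C ^ 2)
  obtain ⟨N, hN⟩ : ∃ N, ∑' i, C ^ 2 * (‖ξ (i + N)‖ ^ 2 + ‖η (i + N)‖ ^ 2) < ε ^ 2 / 2 := by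
    have h := (tendsto_sum_nat_add fun i => C ^ 2 * (‖ξ i‖ ^ 2 + ‖η i‖ ^ 2)).eventually_lt_const
      (show (0 : ℝ) < ε ^ 2 / 2 by positivity)
    exact h.exists
  refine ⟨N, ε / (2 * (N + 1)), by positivity, fun x hx hxξ hxη => ?_⟩
  have hb : ∀ i, ‖⟪x (η i), x (ξ i)⟫_ℂ‖ ≤ C ^ 2 * (‖ξ i‖ ^ 2 + ‖η i‖ ^ 2) := fun i => by
    have h3 := x.le_of_opNorm_le hx (ξ i)
    have h4 := x.le_of_opNorm_le hx (η i)
    refine (norm_inner_le_norm _ _).trans ((mul_le_mul h4 h3 (norm_nonneg _)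
      ((norm_nonneg _).trans h4)).trans ?_)
    have h5 : ‖η i‖ * ‖ξ i‖ ≤ ‖ξ i‖ ^ 2 + ‖η i‖ ^ 2 := by
      nlinarith [sq_nonneg (‖ξ i‖ - ‖η i‖), sq_nonneg ‖ξ i‖, sq_nonneg ‖η i‖]
    nlinarith [mul_le_mul_of_nonneg_left h5 (sq_nonneg C)]
  have hsn := Summable.of_nonneg_of_le (fun i => norm_nonneg _) hb hs
  refine (norm_tsum_le_tsum_norm hsn).trans_lt ?_
  rw [← hsn.sum_add_tsum_nat_add N]
  have htail : ∑' i, ‖⟪x (η (i + N)), x (ξ (i + N))⟫_ℂ‖ < ε ^ 2 / 2 :=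
    (((summable_nat_add_iff N).2 hsn).tsum_le_tsum (fun i => hb _)
      ((summable_nat_add_iff N).2 hs)).trans_lt hN
  have hhead : ∑ i ∈ Finset.range N, ‖⟪x (η i), x (ξ i)⟫_ℂ‖ ≤ ε ^ 2 / 2 := by
    have h3 : ∀ i ∈ Finset.range N, ‖⟪x (η i), x (ξ i)⟫_ℂ‖ ≤
        (ε / (2 * (N + 1))) * (ε / (2 * (N + 1))) := fun i hi =>
      (norm_inner_le_norm _ _).trans (mul_le_mul (hxη i (Finset.mem_range.1 hi)).le
        (hxξ i (Finset.mem_range.1 hi)).le (norm_nonneg _) (by positivity))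
    refine (Finset.sum_le_sum h3).trans ?_
    rw [Finset.sum_const, Finset.card_range, nsmul_eq_mul]
    have hN0 : (0 : ℝ) ≤ N := Nat.cast_nonneg N
    rw [div_mul_div_comm, mul_div_assoc', div_le_div_iff₀ (by positivity) (by positivity)]
    nlinarith [mul_nonneg hN0 (sq_nonneg ε), mul_nonneg (mul_nonneg hN0 hN0) (sq_nonneg ε),
      sq_nonneg ε]
  linarith

/-- On bounded parts of a finite von Neumann algebra the `2`-norm is controlled by finitely many
vectors. -/
theorem IsFaithfulNormalTrace.exists_control {M : VonNeumannAlgebra H}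
    {τ : M.toStarSubalgebra →ₗ[ℂ] ℂ} (hτ : IsFaithfulNormalTrace τ) (C : ℝ) {ε : ℝ} (hε : 0 < ε) :
    ∃ (N : ℕ) (ξ η : Fin N → H) (δ : ℝ), 0 < δ ∧ ∀ x : M.toStarSubalgebra,
      ‖(x : H →L[ℂ] H)‖ ≤ C →
      (∀ i, ‖(x : H →L[ℂ] H) (ξ i)‖ < δ) → (∀ i, ‖(x : H →L[ℂ] H) (η i)‖ < δ) →
      ‖hτ.toFaithfulTrace.toL2 x‖ < ε := by
  obtain ⟨ξ, η, hξ, hη, hsum⟩ := hτ.normal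
  obtain ⟨N, δ, hδ, h⟩ := exists_control_tsum_inner hξ hη C hε
  refine ⟨N, fun i => ξ i, fun i => η i, δ, hδ, fun x hx hxξ hxη => ?_⟩
  have h1 : ∀ i, ⟪η i, ((star x * x : M.toStarSubalgebra) : H →L[ℂ] H) (ξ i)⟫_ℂ =
      ⟪(x : H →L[ℂ] H) (η i), (x : H →L[ℂ] H) (ξ i)⟫_ℂ := fun i =>
    ContinuousLinearMap.adjoint_inner_right (x : H →L[ℂ] H) (η i) ((x : H →L[ℂ] H) (ξ i))
  have h2 := (hsum (star x * x)).tsum_eq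
  simp only [h1] at h2
  rw [← pow_lt_pow_iff_left₀ (norm_nonneg _) hε.le two_ne_zero, FaithfulTrace.norm_toL2_sq]
  refine (Complex.re_le_norm _).trans_lt ?_
  have h3 := h x hx (fun i hi => hxξ ⟨i, hi⟩) (fun i hi => hxη ⟨i, hi⟩)
  rw [h2] at h3
  exact h3

end Separability

/-- A finite von Neumann algebra on a separable Hilbert space contains, in its matrix algebras,
non-trivial projective representations of `ℤ²ⁿ ⋊ Γ` for at most countably many of the cocycles. -/
theorem countable_projectiveReps {n : ℕ} (hn : 1 ≤ n)
    {Γ : Subgroup (Matrix.symplecticGroup (Fin n) ℤ)}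
    (hT : HasRelativePropertyT (latticeSubgroup n Γ))
    {r : Circle → Circle} (hr : ∀ α, r α ^ 2 = α)
    {H : Type u} [NormedAddCommGroup H] [InnerProductSpace ℂ H] [CompleteSpace H]
    [TopologicalSpace.SeparableSpace H] {M : VonNeumannAlgebra H}
    {τ : M.toStarSubalgebra →ₗ[ℂ] ℂ} (hτ : IsFaithfulNormalTrace τ) :
    {α : Circle | ∃ (m : ℕ) (u : LatticeSemidirect n Γ → Matrix (Fin m) (Fin m) M.toStarSubalgebra),
      IsProjectiveRep (latticeCocycle Γ (r α)) u ∧ u 1 ≠ 0}.Countable := by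
  -- The finite set does not depend on the lower bound `t`, so it can be fixed before stratifying by
  -- matrix size `m`, by a lower bound for `‖u 1‖` and by an upper bound for the entries on `F`.
  obtain ⟨F, hF⟩ := HasRelativePropertyT.exists_rigidity.{u} hT
  let T := hτ.toFaithfulTrace
  let S : ℕ → ℕ → Set Circle := fun m j => {α | ∃ u : LatticeSemidirect n Γ →
    Matrix (Fin m) (Fin m) M.toStarSubalgebra, IsProjectiveRep (latticeCocycle Γ (r α)) u ∧
      1 / ((j : ℝ) + 1) ≤ ‖(T.matrix (Fin m)).toL2 (u 1)‖ ∧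
      ∀ g ∈ F, ∀ i k, ‖(u g i k : H →L[ℂ] H)‖ ≤ j}
  have hcover : {α : Circle | ∃ (m : ℕ) (u : LatticeSemidirect n Γ →
      Matrix (Fin m) (Fin m) M.toStarSubalgebra),
      IsProjectiveRep (latticeCocycle Γ (r α)) u ∧ u 1 ≠ 0} ⊆ ⋃ m, ⋃ j, S m j := by
    rintro α ⟨m, u, hu, hu1⟩
    have h0 : 0 < ‖(T.matrix (Fin m)).toL2 (u 1)‖ := by
      rw [norm_pos_iff]
      simpa using hu1
    obtain ⟨j₁, hj₁⟩ := exists_nat_one_div_lt h0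
    obtain ⟨j₂, hj₂⟩ := exists_nat_ge (∑ g ∈ F, ∑ i, ∑ k, ‖(u g i k : H →L[ℂ] H)‖)
    refine Set.mem_iUnion₂.2 ⟨m, max j₁ j₂, u, hu, ?_, fun g hg i k => ?_⟩
    · refine le_trans ?_ hj₁.le
      gcongr
      exact le_max_left _ _
    · have h1 : ‖(u g i k : H →L[ℂ] H)‖ ≤ ∑ g ∈ F, ∑ i, ∑ k, ‖(u g i k : H →L[ℂ] H)‖ :=
        ((Finset.single_le_sum (f := fun k => ‖(u g i k : H →L[ℂ] H)‖)
          (fun _ _ => norm_nonneg _) (Finset.mem_univ k)).trans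
        (Finset.single_le_sum (f := fun i => ∑ k, ‖(u g i k : H →L[ℂ] H)‖)
          (fun _ _ => Finset.sum_nonneg fun _ _ => norm_nonneg _) (Finset.mem_univ i))).trans
        (Finset.single_le_sum (f := fun g => ∑ i, ∑ k, ‖(u g i k : H →L[ℂ] H)‖)
          (fun _ _ => Finset.sum_nonneg fun _ _ => Finset.sum_nonneg fun _ _ => norm_nonneg _) hg)
      refine (h1.trans hj₂).trans ?_
      exact_mod_cast le_max_right _ _
  refine (Set.countable_iUnion fun m => Set.countable_iUnion fun j => ?_).mono hcover
  obtain ⟨ε, hε, hrig⟩ := hF (1 / ((j : ℝ) + 1)) (by positivity)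
  -- Differences of two entries are bounded by `2j`, and `m²` entries of 2-norm at most `ε / (m +
  -- 1)` add up to strictly less than `ε`, also for `m = 0`.
  obtain ⟨N, ξ, η, δ, hδ, hcontrol⟩ := hτ.exists_control (2 * (j : ℝ))
    (show 0 < ε / (m + 1) by positivity)
  have hex : ∀ α, ∃ u : LatticeSemidirect n Γ → Matrix (Fin m) (Fin m) M.toStarSubalgebra,
      α ∈ S m j → IsProjectiveRep (latticeCocycle Γ (r α)) u ∧
      1 / ((j : ℝ) + 1) ≤ ‖(T.matrix (Fin m)).toL2 (u 1)‖ ∧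
      ∀ g ∈ F, ∀ i k, ‖(u g i k : H →L[ℂ] H)‖ ≤ j := fun α => by
    by_cases h : α ∈ S m j
    · obtain ⟨u, hu⟩ := h
      exact ⟨u, fun _ => hu⟩
    · exact ⟨fun _ => 0, fun h' => absurd h' h⟩
  choose u hu using hex
  -- The values on the test vectors live in a finite product of copies of `H`, which is separable.
  let Θ : Circle → F → Fin m → Fin m → (Fin N → H) × (Fin N → H) := fun α g i k =>
    (fun a => (u α g i k : H →L[ℂ] H) (ξ a), fun a => (u α g i k : H →L[ℂ] H) (η a))
  refine Set.Countable.of_close Θ hδ (fun α β => IsOfFinOrder (α * β⁻¹)) ?_ ?_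
  · intro α hα β hβ hαβ
    obtain ⟨hu₁, ht, hb₁⟩ := hu α hα
    obtain ⟨hu₂, -, hb₂⟩ := hu β hβ
    have hclose : ∀ g ∈ F, ‖(T.matrix (Fin m)).toL2 (u α g - u β g)‖ < ε := by
      intro g hg
      have hentry : ∀ i k, ‖T.toL2 ((u α g - u β g) i k)‖ ≤ ε / (m + 1) := by
        intro i k
        have hd : dist (Θ α ⟨g, hg⟩ i k) (Θ β ⟨g, hg⟩ i k) < δ :=
          ((dist_le_pi_dist (Θ α ⟨g, hg⟩ i) (Θ β ⟨g, hg⟩ i) k).trans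
            ((dist_le_pi_dist (Θ α ⟨g, hg⟩) (Θ β ⟨g, hg⟩) i).trans
              (dist_le_pi_dist (Θ α) (Θ β) ⟨g, hg⟩))).trans_lt hαβ
        rw [Prod.dist_eq, max_lt_iff] at hd
        refine (hcontrol _ ?_ (fun a => ?_) fun a => ?_).le
        · refine (norm_sub_le (u α g i k : H →L[ℂ] H) (u β g i k : H →L[ℂ] H)).trans ?_
          linarith [hb₁ g hg i k, hb₂ g hg i k]
        · have h := (dist_le_pi_dist _ _ a).trans_lt hd.1
          rwa [dist_eq_norm] at h
        · have h := (dist_le_pi_dist _ _ a).trans_lt hd.2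
          rwa [dist_eq_norm] at h
      rw [← pow_lt_pow_iff_left₀ (norm_nonneg _) hε.le two_ne_zero, FaithfulTrace.norm_matrix_sq]
      calc ∑ i, ∑ k, ‖T.toL2 ((u α g - u β g) i k)‖ ^ 2
          ≤ ∑ _i : Fin m, ∑ _k : Fin m, (ε / (m + 1)) ^ 2 :=
            Finset.sum_le_sum fun i _ => Finset.sum_le_sum fun k _ =>
              pow_le_pow_left₀ (norm_nonneg _) (hentry i k) 2
        _ = (m / (m + 1) * ε) ^ 2 := by
            simp only [Finset.sum_const, Finset.card_univ, Fintype.card_fin, nsmul_eq_mul]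
            ring
        _ < ε ^ 2 := by
            refine pow_lt_pow_left₀ ?_ (by positivity) two_ne_zero
            have : (m : ℝ) / (m + 1) < 1 := by
              rw [div_lt_one (by positivity)]
              linarith
            nlinarith
    -- A dual pair with form value `1`: the commutation factor is then `(r α)² (r β)⁻² = αβ⁻¹`,
    -- independent of the chosen roots.
    let i₀ : Fin n := ⟨0, hn⟩
    let x : ZLattice n := Pi.single (.inl i₀) 1
    let y : ZLattice n := Pi.single (.inr i₀) 1
    have hxy : symplecticForm x y = 1 := by
      rw [symplecticForm_eq_sum]
      simp [x, y, Pi.single_apply]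
    have h := hrig _ (T.matrix (Fin m)) _ _ (u α) (u β) (latticeCocycle_isNormalized Γ (r α))
      (latticeCocycle_isNormalized Γ (r β)) hu₁ hu₂ ht hclose
      (SemidirectProduct.inl (Multiplicative.ofAdd x)) ⟨_, rfl⟩
      (SemidirectProduct.inl (Multiplicative.ofAdd y)) ⟨_, rfl⟩
      (by
        rw [← map_mul (SemidirectProduct.inl : Multiplicative (ZLattice n) →* LatticeSemidirect n Γ),
          mul_comm, map_mul])
    rw [latticeCocycle_inl, latticeCocycle_inl, latticeCocycle_inl, latticeCocycle_inl,
      symplecticForm_swap x y, hxy] at h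
    have h2 : r α ^ (1 : ℤ) * (r β ^ (1 : ℤ))⁻¹ * (r α ^ (-1 : ℤ) * (r β ^ (-1 : ℤ))⁻¹)⁻¹ =
        α * β⁻¹ := by
      conv_rhs => rw [← hr α, ← hr β]
      simp only [zpow_one, zpow_neg, mul_inv, inv_inv, pow_two]
      exact mul_mul_mul_comm _ _ _ _
    rwa [h2] at h
  · intro α
    refine (Circle.countable_isOfFinOrder.image fun z => z⁻¹ * α).mono fun β hβ => ?_
    exact ⟨α * β⁻¹, hβ, by simp⟩

/-! ### Trivial centre implies primeness -/

section Factor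

variable {H : Type*} [NormedAddCommGroup H] [InnerProductSpace ℂ H] [CompleteSpace H]

/-- A von Neumann algebra with trivial centre is a prime ring. -/
theorem VonNeumannAlgebra.eq_zero_of_mul_mul_eq_zero {N : VonNeumannAlgebra H}
    (hN : ∀ x ∈ N, x ∈ N.commutant → ∃ c : ℂ, x = c • (1 : H →L[ℂ] H))
    {r z : H →L[ℂ] H} (hz : z ∈ N) (hz0 : z ≠ 0) (h : ∀ x ∈ N, r * x * z = 0) : r = 0 := by
  -- The closure of `N z H` is invariant under `N` and under its commutant, so its projection is
  -- central, hence a non-zero scalar; `r` vanishes on that subspace.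
  let E₀ : Submodule ℂ H := Submodule.span ℂ {w | ∃ x ∈ N, ∃ ξ, w = x (z ξ)}
  let E : Submodule ℂ H := E₀.topologicalClosure
  have hE : ∀ t : H →L[ℂ] H, (∀ x ∈ N, ∀ ξ, t (x (z ξ)) ∈ E₀) → ∀ w ∈ E, t w ∈ E := by
    intro t ht w hw
    refine map_mem_closure t.continuous hw fun w hw => ?_
    induction hw using Submodule.span_induction with
    | mem w hw => obtain ⟨x, hx, ξ, rfl⟩ := hw; exact ht x hx ξ
    | zero => simp
    | add a b _ _ ha hb => rw [map_add]; exact E₀.add_mem ha hb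
    | smul c a _ ha => rw [map_smul]; exact E₀.smul_mem c ha
  have : CompleteSpace E := E₀.isClosed_topologicalClosure.completeSpace_coe
  have hp : IsStarProjection E.starProjection := isStarProjection_starProjection
  have hrange : E.starProjection.range = E := E.range_starProjection
  have hmem : E.starProjection ∈ N := by
    rw [VonNeumannAlgebra.IsStarProjection.mem_iff hp]
    intro t ht
    rw [hrange]
    refine fun w hw => hE t (fun x hx ξ => Submodule.subset_span ⟨x, hx, t ξ, ?_⟩) w hw
    have h1 := VonNeumannAlgebra.mem_commutant_iff.1 ht x hx
    have h2 := VonNeumannAlgebra.mem_commutant_iff.1 ht z hz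
    calc t (x (z ξ)) = (t * x) (z ξ) := rfl
      _ = x ((t * z) ξ) := by rw [← h1]; rfl
      _ = x (z (t ξ)) := by rw [← h2]; rfl
  have hmem' : E.starProjection ∈ N.commutant := by
    rw [VonNeumannAlgebra.IsStarProjection.mem_iff hp]
    intro t ht
    rw [hrange]
    rw [VonNeumannAlgebra.commutant_commutant] at ht
    exact fun w hw => hE t (fun x hx ξ =>
      Submodule.subset_span ⟨t * x, mul_mem ht hx, ξ, rfl⟩) w hw
  obtain ⟨c, hc⟩ := hN _ hmem hmem'
  obtain ⟨ξ, hξ⟩ : ∃ ξ, z ξ ≠ 0 := by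
    by_contra! h0
    exact hz0 (ContinuousLinearMap.ext h0)
  have hzE : z ξ ∈ E := subset_closure (Submodule.subset_span ⟨1, one_mem N, ξ, rfl⟩)
  have hc0 : c ≠ 0 := fun h0 => by
    have h1 := Submodule.starProjection_eq_self_iff.2 hzE
    rw [hc, h0, zero_smul] at h1
    exact hξ h1.symm
  have hker : ∀ w ∈ E, r w = 0 := by
    intro w hw
    have h1 : w ∈ closure (E₀ : Set H) := hw
    refine closure_minimal (s := (E₀ : Set H)) (t := {w | r w = 0}) (fun w hw => ?_)
      (isClosed_eq r.continuous continuous_const) h1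
    change w ∈ E₀ at hw
    change r w = 0
    induction hw using Submodule.span_induction with
    | mem w hw => obtain ⟨x, hx, ξ, rfl⟩ := hw; exact congrArg (fun T => T ξ) (h x hx)
    | zero => simp
    | add a b _ _ ha hb => rw [map_add, ha, hb, add_zero]
    | smul c a _ ha => rw [map_smul, ha, smul_zero]
  ext w
  have h1 : E.starProjection w ∈ E := E.starProjection_apply_mem w
  have h2 := hker _ h1
  rw [hc] at h2
  have h3 : c • r w = 0 := by rw [← map_smul]; exact h2
  simpa [hc0] using h3

end Factor

/-! ### Extreme points of a ball of rows -/

section KreinMilman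

variable {H : Type*} [NormedAddCommGroup H] [InnerProductSpace ℂ H] [CompleteSpace H]
  {ι : Type*} [Fintype ι]

/-- The rows over a von Neumann algebra that are contractions and are fixed by `P`. -/
def rowBall (N : VonNeumannAlgebra H) (P : Matrix ι ι N.toStarSubalgebra) :
    Set (ι → N.toStarSubalgebra) :=
  {v | (∀ j, ∑ i, v i * P i j = v j) ∧
    ((∑ i, v i * star (v i) : N.toStarSubalgebra) : H →L[ℂ] H) ≤ 1}

theorem sum_mul_star_le_one_iff_sum_norm (N : VonNeumannAlgebra H) (v : ι → N.toStarSubalgebra) :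
    ((∑ i, v i * star (v i) : N.toStarSubalgebra) : H →L[ℂ] H) ≤ 1 ↔
      ∀ η : H, ∑ i, ‖(star (v i : H →L[ℂ] H)) η‖ ^ 2 ≤ ‖η‖ ^ 2 := by
  have h1 : ∀ η : H, ⟪(1 - ((∑ i, v i * star (v i) : N.toStarSubalgebra) : H →L[ℂ] H)) η, η⟫_ℂ =
      ((‖η‖ ^ 2 - ∑ i, ‖(star (v i : H →L[ℂ] H)) η‖ ^ 2 : ℝ) : ℂ) := fun η => by
    have h2 : ((∑ i, v i * star (v i) : N.toStarSubalgebra) : H →L[ℂ] H) η =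
        ∑ i, (v i : H →L[ℂ] H) ((star (v i : H →L[ℂ] H)) η) := by
      rw [AddSubmonoidClass.coe_finsetSum, sum_apply]
      rfl
    rw [sub_apply, inner_sub_left, h2, sum_inner]
    push_cast
    congr 1
    · exact inner_self_eq_norm_sq_to_K η
    · refine Finset.sum_congr rfl fun i _ => ?_
      rw [← ContinuousLinearMap.adjoint_inner_right]
      exact inner_self_eq_norm_sq_to_K _
  rw [ContinuousLinearMap.le_def, ContinuousLinearMap.isPositive_iff_complex]
  simp only [h1, Complex.ofReal_re, true_and, sub_nonneg, RCLike.re_to_complex]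

/-- Each inequality on the right involves finitely many matrix coefficients, so it passes to
pointwise limits. Cauchy–Schwarz gives one direction, and `ξ i = (v i)* η` the other. -/
theorem sum_mul_star_le_one_iff (N : VonNeumannAlgebra H) (v : ι → N.toStarSubalgebra) :
    ((∑ i, v i * star (v i) : N.toStarSubalgebra) : H →L[ℂ] H) ≤ 1 ↔
      ∀ (η : H) (ξ : ι → H), ‖∑ i, ⟪η, (v i : H →L[ℂ] H) (ξ i)⟫_ℂ‖ ≤
        ‖η‖ * √(∑ i, ‖ξ i‖ ^ 2) := by
  rw [sum_mul_star_le_one_iff_sum_norm]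
  have hadj : ∀ i η ξ, ⟪η, (v i : H →L[ℂ] H) ξ⟫_ℂ = ⟪(star (v i : H →L[ℂ] H)) η, ξ⟫_ℂ :=
    fun i η ξ => (ContinuousLinearMap.adjoint_inner_left _ _ _).symm
  simp only [hadj]
  constructor
  · intro h η ξ
    calc ‖∑ i, ⟪(star (v i : H →L[ℂ] H)) η, ξ i⟫_ℂ‖
        ≤ ∑ i, ‖(star (v i : H →L[ℂ] H)) η‖ * ‖ξ i‖ :=
          (norm_sum_le _ _).trans (Finset.sum_le_sum fun i _ => norm_inner_le_norm _ _)
      _ ≤ √(∑ i, ‖(star (v i : H →L[ℂ] H)) η‖ ^ 2) * √(∑ i, ‖ξ i‖ ^ 2) :=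
          Real.sum_mul_le_sqrt_mul_sqrt _ _ _
      _ ≤ ‖η‖ * √(∑ i, ‖ξ i‖ ^ 2) := by
          gcongr
          exact Real.sqrt_le_left (norm_nonneg _) |>.2 (h η)
  · intro h η
    have h1 := h η fun i => (star (v i : H →L[ℂ] H)) η
    set S := ∑ i, ‖(star (v i : H →L[ℂ] H)) η‖ ^ 2 with hS
    have hS0 : 0 ≤ S := Finset.sum_nonneg fun i _ => sq_nonneg _
    have h2 : ∑ i, ⟪(star (v i : H →L[ℂ] H)) η, (star (v i : H →L[ℂ] H)) η⟫_ℂ = ((S : ℝ) : ℂ) := by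
      rw [hS]
      push_cast
      exact Finset.sum_congr rfl fun i _ => inner_self_eq_norm_sq_to_K _
    rw [h2, Complex.norm_real, Real.norm_of_nonneg hS0] at h1
    have h3 := Real.sq_sqrt hS0
    have h4 := Real.sqrt_nonneg S
    by_contra! h5
    have h6 : ‖η‖ < √S := Real.lt_sqrt_of_sq_lt h5
    nlinarith [norm_nonneg η]

/-- The matrix coefficients of a row of operators. -/
noncomputable def rowCoeff (N : VonNeumannAlgebra H) (v : ι → N.toStarSubalgebra)
    (a : ι × H × H) : ℂ :=
  ⟪a.2.1, (v a.1 : H →L[ℂ] H) a.2.2⟫_ℂ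

/-- A bounded sesquilinear form is the matrix coefficient function of an operator. -/
theorem exists_operator_of_form (f : H → H → ℂ) (C : ℝ)
    (hadd : ∀ η ξ ξ', f η (ξ + ξ') = f η ξ + f η ξ') (hsmul : ∀ (c : ℂ) η ξ, f η (c • ξ) = c * f η ξ)
    (hadd' : ∀ η η' ξ, f (η + η') ξ = f η ξ + f η' ξ)
    (hsmul' : ∀ (c : ℂ) η ξ, f (c • η) ξ = (starRingEnd ℂ) c * f η ξ)
    (hb : ∀ η ξ, ‖f η ξ‖ ≤ C * ‖η‖ * ‖ξ‖) : ∃ T : H →L[ℂ] H, ∀ η ξ, f η ξ = ⟪η, T ξ⟫_ℂ := by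
  let B : H →L⋆[ℂ] H →L[ℂ] ℂ := LinearMap.mkContinuous₂
    (LinearMap.mk₂'ₛₗ (starRingEnd ℂ) (RingHom.id ℂ) f hadd' (fun c η ξ => hsmul' c η ξ) hadd
      (fun c η ξ => hsmul c η ξ)) C hb
  refine ⟨star (InnerProductSpace.continuousLinearMapOfBilin B), fun η ξ => ?_⟩
  rw [ContinuousLinearMap.star_eq_adjoint, ContinuousLinearMap.adjoint_inner_right,
    InnerProductSpace.continuousLinearMapOfBilin_apply]
  rfl

/-- Weak operator compactness via Tychonoff: the coefficient functions are cut out of a product of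
discs by closed conditions, namely sesquilinearity, commutation with the commutant, invariance under
`P` and contractivity. Bounded forms come from operators, and the double commutant puts these in
`N`. -/
theorem isCompact_rowCoeff_image (N : VonNeumannAlgebra H) (P : Matrix ι ι N.toStarSubalgebra) :
    IsCompact (rowCoeff N '' rowBall N P) := by
  classical
  let K : Set (ι × H × H → ℂ) := {F |
    (∀ i η ξ ξ', F (i, η, ξ + ξ') = F (i, η, ξ) + F (i, η, ξ')) ∧
    (∀ i (c : ℂ) η ξ, F (i, η, c • ξ) = c * F (i, η, ξ)) ∧
    (∀ i η η' ξ, F (i, η + η', ξ) = F (i, η, ξ) + F (i, η', ξ)) ∧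
    (∀ i (c : ℂ) η ξ, F (i, c • η, ξ) = (starRingEnd ℂ) c * F (i, η, ξ)) ∧
    (∀ i, ∀ t ∈ N.commutant, ∀ η ξ, F (i, η, t ξ) = F (i, star t η, ξ)) ∧
    (∀ j η ξ, ∑ i, F (i, η, (P i j : H →L[ℂ] H) ξ) = F (j, η, ξ)) ∧
    ∀ (η : H) (ξ : ι → H), ‖∑ i, F (i, η, ξ i)‖ ≤ ‖η‖ * √(∑ i, ‖ξ i‖ ^ 2)}
  have hbound : ∀ F ∈ K, ∀ i η ξ, ‖F (i, η, ξ)‖ ≤ 1 * ‖η‖ * ‖ξ‖ := by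
    rintro F ⟨h1, h2, h3, h4, h5, h6, h7⟩ i η ξ
    have hz : ∀ j, F (j, η, 0) = 0 := fun j => by
      have := h2 j 0 η 0
      rwa [zero_smul, zero_mul] at this
    have h := h7 η (Pi.single i ξ)
    rw [Finset.sum_eq_single i (fun j _ hj => by rw [Pi.single_eq_of_ne hj, hz])
      (fun hi => absurd (Finset.mem_univ i) hi), Finset.sum_eq_single i
      (fun j _ hj => by rw [Pi.single_eq_of_ne hj]; simp)
      (fun hi => absurd (Finset.mem_univ i) hi), Pi.single_eq_same, Real.sqrt_sq (norm_nonneg _)] at h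
    rwa [one_mul]
  have hclosed : IsClosed K := by
    simp only [K, Set.ofPred_and, Set.ofPred_forall]
    refine IsClosed.inter ?_ (IsClosed.inter ?_ (IsClosed.inter ?_ (IsClosed.inter ?_
      (IsClosed.inter ?_ (IsClosed.inter ?_ ?_))))) <;>
    first
    | (repeat' refine isClosed_iInter fun _ => ?_
       first
       | exact isClosed_eq (by fun_prop) (by fun_prop)
       | exact isClosed_le (by fun_prop) (by fun_prop))
  have hcompact : IsCompact K := by
    refine IsCompact.of_isClosed_subset
      (isCompact_univ_pi fun a : ι × H × H => isCompact_closedBall (0 : ℂ) (1 * ‖a.2.1‖ * ‖a.2.2‖))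
      hclosed fun F hF a _ => ?_
    rw [mem_closedBall_zero_iff]
    exact hbound F hF _ _ _
  have hK : rowCoeff N '' rowBall N P = K := by
    apply Set.Subset.antisymm
    · rintro _ ⟨v, ⟨hv, hv1⟩, rfl⟩
      refine ⟨fun i η ξ ξ' => ?_, fun i c η ξ => ?_, fun i η η' ξ => ?_, fun i c η ξ => ?_,
        fun i t ht η ξ => ?_, fun j η ξ => ?_, (sum_mul_star_le_one_iff N v).1 hv1⟩ <;>
        simp only [rowCoeff]
      · rw [map_add, inner_add_right]
      · rw [map_smul, inner_smul_right]
      · rw [inner_add_left]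
      · rw [inner_smul_left]
      · have h := VonNeumannAlgebra.mem_commutant_iff.1 ht _ (v i).2
        rw [ContinuousLinearMap.star_eq_adjoint, ContinuousLinearMap.adjoint_inner_left]
        exact congrArg (fun T : H →L[ℂ] H => ⟪η, T ξ⟫_ℂ) h
      · rw [← inner_sum]
        have h := congrArg (fun T : N.toStarSubalgebra => (T : H →L[ℂ] H) ξ) (hv j)
        simp only [AddSubmonoidClass.coe_finsetSum, sum_apply] at h
        rw [← h]
        rfl
    · intro F hF
      have hbF := hbound F hF
      obtain ⟨h1, h2, h3, h4, h5, h6, h7⟩ := hF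
      choose T hT using fun i => exists_operator_of_form (fun η ξ => F (i, η, ξ)) 1 (h1 i) (h2 i)
        (h3 i) (h4 i) (hbF i)
      have hTN : ∀ i, T i ∈ N := fun i => by
        rw [← VonNeumannAlgebra.commutant_commutant N, VonNeumannAlgebra.mem_commutant_iff]
        intro t ht
        ext ξ
        refine ext_inner_left ℂ fun η => ?_
        have h := h5 i t ht η ξ
        rw [hT, hT, ContinuousLinearMap.star_eq_adjoint,
          ContinuousLinearMap.adjoint_inner_left] at h
        exact h.symm
      have hF : rowCoeff N (fun i => ⟨T i, hTN i⟩) = F := by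
        ext ⟨i, η, ξ⟩
        exact (hT i η ξ).symm
      refine ⟨fun i => ⟨T i, hTN i⟩, ⟨fun j => ?_, ?_⟩, hF⟩
      · apply Subtype.ext
        ext ξ
        refine ext_inner_left ℂ fun η => ?_
        have h := h6 j η ξ
        simp only [hT, ← inner_sum] at h
        rw [← h]
        simp only [AddSubmonoidClass.coe_finsetSum, sum_apply]
        rfl
      · rw [sum_mul_star_le_one_iff]
        intro η ξ
        have h := h7 η ξ
        simp only [hT] at h
        exact h
  rw [hK]
  exact hcompact

/-- Krein–Milman applied to the compact set of coefficient functions. Passing to coefficients is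
additive and injective, so extremality pulls back to rows, in the form of excluding perturbations `v
± w`. -/
theorem exists_extreme_row (N : VonNeumannAlgebra H) (P : Matrix ι ι N.toStarSubalgebra) :
    ∃ v ∈ rowBall N P, ∀ w, v + w ∈ rowBall N P → v - w ∈ rowBall N P → w = 0 := by
  have h0 : (0 : ι → N.toStarSubalgebra) ∈ rowBall N P := by
    refine ⟨fun j => by simp, ?_⟩
    simp
  obtain ⟨F, ⟨v, hv, rfl⟩, hext⟩ :=
    (isCompact_rowCoeff_image N P).extremePoints_nonempty ⟨_, 0, h0, rfl⟩
  refine ⟨v, hv, fun w hw hw' => ?_⟩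
  have hadd : ∀ v w : ι → N.toStarSubalgebra, rowCoeff N (v + w) = rowCoeff N v + rowCoeff N w :=
    fun v w => funext fun a => by
      simp only [rowCoeff, Pi.add_apply]
      rw [← inner_add_right]
      rfl
  have hneg : rowCoeff N (-w) = -rowCoeff N w := funext fun a => by
    simp only [rowCoeff, Pi.neg_apply]
    rw [← inner_neg_right]
    rfl
  have hmem : rowCoeff N v ∈ openSegment ℝ (rowCoeff N (v + w)) (rowCoeff N (v - w)) := by
    refine ⟨1 / 2, 1 / 2, by norm_num, by norm_num, by norm_num, ?_⟩
    rw [sub_eq_add_neg, hadd, hadd, hneg, ← smul_add]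
    ext a
    simp only [Pi.smul_apply, Pi.add_apply, Pi.neg_apply, Complex.real_smul]
    push_cast
    ring
  have h := hext ⟨_, hw, rfl⟩ ⟨_, hw', rfl⟩ hmem
  rw [hadd, add_eq_left] at h
  funext i
  apply Subtype.ext
  ext ξ
  refine ext_inner_left ℂ fun η => ?_
  have h1 := congrFun h (i, η, ξ)
  simpa [rowCoeff] using h1

end KreinMilman

/-! ### Comparison of projections -/

section Comparison

variable {H : Type*} [NormedAddCommGroup H] [InnerProductSpace ℂ H] [CompleteSpace H]

/-- In a `C*`-algebra, `a (3 - a)² ≤ 4` and `a (1 + a)² ≤ 4` for `0 ≤ a ≤ 1`. -/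
theorem conj_add_le_one_of_le_one {a : H →L[ℂ] H} (ha : 0 ≤ a) (ha1 : a ≤ 1) :
    (1 + (1 / 2 : ℂ) • (1 - a)) * a * (1 + (1 / 2 : ℂ) • (1 - a)) ≤ 1 ∧
      (1 - (1 / 2 : ℂ) • (1 - a)) * a * (1 - (1 / 2 : ℂ) • (1 - a)) ≤ 1 := by
  have hhalf : ∀ x : H →L[ℂ] H, (1 / 2 : ℂ) • x = (1 / 2 : ℝ) • x := fun x => by
    rw [← Complex.coe_smul]
    norm_num
  simp only [hhalf]
  have hsa : star a = a := (IsSelfAdjoint.of_nonneg ha).star_eq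
  have hsb : star (1 - a) = 1 - a := by rw [star_sub, star_one, hsa]
  have hb : 0 ≤ 1 - a := sub_nonneg.2 ha1
  have h1 : 0 ≤ (1 - a) * (1 - a) := by
    have := star_left_conjugate_nonneg (show (0 : H →L[ℂ] H) ≤ 1 from zero_le_one) (1 - a)
    rwa [hsb, mul_one] at this
  have h2 : 0 ≤ (1 - a) * (1 - a) * (1 - a) := by
    have := star_left_conjugate_nonneg hb (1 - a)
    rwa [hsb] at this
  have h3 : 0 ≤ a * (1 - a) * a := by
    have := star_left_conjugate_nonneg hb a
    rwa [hsa] at this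
  have h4 : 0 ≤ (1 - a) * a * (1 - a) := by
    have := star_left_conjugate_nonneg ha (1 - a)
    rwa [hsb] at this
  constructor
  · have h5 : (1 : H →L[ℂ] H) - (1 + (1 / 2 : ℝ) • (1 - a)) * a * (1 + (1 / 2 : ℝ) • (1 - a)) =
        (3 / 4 : ℝ) • ((1 - a) * (1 - a)) + (1 / 4 : ℝ) • ((1 - a) * (1 - a) * (1 - a)) := by
      simp only [smul_sub, mul_add, add_mul, mul_sub, sub_mul, mul_one, one_mul, smul_mul_assoc,
        mul_smul_comm]
      module
    rw [← sub_nonneg, h5]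
    exact add_nonneg (smul_nonneg (by norm_num) h1) (smul_nonneg (by norm_num) h2)
  · have h5 : (1 : H →L[ℂ] H) - (1 - (1 / 2 : ℝ) • (1 - a)) * a * (1 - (1 / 2 : ℝ) • (1 - a)) =
        (1 - a) + (1 : ℝ) • (a * (1 - a) * a) + (3 / 4 : ℝ) • ((1 - a) * a * (1 - a)) := by
      simp only [smul_sub, mul_sub, sub_mul, mul_one, one_mul, smul_mul_assoc, mul_smul_comm]
      module
    rw [← sub_nonneg, h5]
    exact add_nonneg (add_nonneg hb (smul_nonneg (by norm_num) h3)) (smul_nonneg (by norm_num) h4)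

/-- With `s = 1 / (1 + ‖m‖)`, use `m ≤ ‖m‖`. The square of `s` appears because the scalar will
multiply a row `y`, and hence `y y*` by `s²`. -/
theorem exists_smul_le_one {m : H →L[ℂ] H} (hm : 0 ≤ m) :
    ∃ s : ℝ, 0 < s ∧ ((s : ℂ) * s) • m ≤ 1 := by
  have h0 : 0 < 1 + ‖m‖ := by positivity
  refine ⟨(1 + ‖m‖)⁻¹, inv_pos.2 h0, ?_⟩
  have h1 : (((1 + ‖m‖)⁻¹ : ℝ) : ℂ) * (((1 + ‖m‖)⁻¹ : ℝ) : ℂ) =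
      (((1 + ‖m‖)⁻¹ * (1 + ‖m‖)⁻¹ : ℝ) : ℂ) := by push_cast; rfl
  rw [h1, Complex.coe_smul]
  have h2 : m ≤ ‖m‖ • (1 : H →L[ℂ] H) := by
    rw [← Algebra.algebraMap_eq_smul_one]
    exact (IsSelfAdjoint.of_nonneg hm).le_algebraMap_norm_self
  have h3 : ((1 + ‖m‖)⁻¹ * (1 + ‖m‖)⁻¹) * ‖m‖ ≤ 1 := by
    rw [← mul_inv, inv_mul_le_iff₀ (by positivity)]
    nlinarith [norm_nonneg m]
  refine (smul_le_smul_of_nonneg_left h2 (by positivity)).trans ?_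
  rw [smul_smul]
  have h4 : (0 : H →L[ℂ] H) ≤ (1 - (1 + ‖m‖)⁻¹ * (1 + ‖m‖)⁻¹ * ‖m‖) • (1 : H →L[ℂ] H) :=
    smul_nonneg (sub_nonneg.2 h3) zero_le_one
  rwa [sub_smul, one_smul, sub_nonneg] at h4

variable {ι : Type*} [Fintype ι]

/-- Comparison of projections: in a finite factor `N`, a projection of a matrix algebra of `N` with
trace larger than `1` dominates a copy of `1`. -/
theorem exists_row_mul_star_eq_one [DecidableEq ι] {N : VonNeumannAlgebra H}
    (hN : ∀ x ∈ N, x ∈ N.commutant → ∃ c : ℂ, x = c • (1 : H →L[ℂ] H))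
    (τ : FaithfulTrace N.toStarSubalgebra) {P : Matrix ι ι N.toStarSubalgebra}
    (hP : IsStarProjection P)
    (htr : (τ.toLinearMap 1).re < (∑ i, τ.toLinearMap (P i i)).re) :
    ∃ v : ι → N.toStarSubalgebra, (∀ j, ∑ i, v i * P i j = v j) ∧ ∑ i, v i * star (v i) = 1 := by
  obtain ⟨v, ⟨hvP, hv1⟩, hext⟩ := exists_extreme_row N P
  set a : N.toStarSubalgebra := ∑ i, v i * star (v i) with ha_def
  have hsa : star a = a := by
    rw [ha_def, star_sum]
    exact Finset.sum_congr rfl fun i _ => by rw [star_mul, star_star]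
  have ha0 : (0 : H →L[ℂ] H) ≤ a := by
    rw [ha_def, AddSubmonoidClass.coe_finsetSum]
    exact Finset.sum_nonneg fun i _ => mul_star_self_nonneg (v i : H →L[ℂ] H)
  have hPP : ∀ i j, ∑ k, P i k * P k j = P i j := fun i j => by
    rw [← Matrix.mul_apply, hP.isIdempotentElem.eq]
  have hPs : ∀ i j, star (P i j) = P j i := fun i j => by
    rw [← Matrix.star_apply, hP.isSelfAdjoint.star_eq]
  obtain ⟨hc₁, hc₂⟩ := conj_add_le_one_of_le_one ha0 hv1
  -- the sum over a row multiplied from the left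
  have hleft : ∀ c : N.toStarSubalgebra, star c = c →
      ∑ i, (c * v i) * star (c * v i) = c * a * c := fun c hc => by
    rw [ha_def, Finset.mul_sum, Finset.sum_mul]
    exact Finset.sum_congr rfl fun i _ => by rw [star_mul, hc]; noncomm_ring
  have hleftP : ∀ (c : N.toStarSubalgebra) j, ∑ i, (c * v i) * P i j = c * v j := fun c j => by
    simp only [mul_assoc]
    rw [← Finset.mul_sum, hvP]
  -- The perturbation by `½ (1 - a) v` in either direction stays in the ball, by
  -- `conj_add_le_one_of_le_one`; extremality kills it, so `v` is a partial isometry and `a` a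
  -- projection.
  have hav : ∀ i, a * v i = v i := by
    have h := hext (fun i => (1 / 2 : ℂ) • ((1 - a) * v i)) ?_ ?_
    · intro i
      have h1 := congrFun h i
      simp only [Pi.zero_apply, smul_eq_zero] at h1
      rcases h1 with h1 | h1
      · norm_num at h1
      · rw [sub_mul, one_mul, sub_eq_zero] at h1
        exact h1.symm
    · have h1 : (v + fun i => (1 / 2 : ℂ) • ((1 - a) * v i)) =
          fun i => (1 + (1 / 2 : ℂ) • (1 - a)) * v i := by
        funext i
        simp only [Pi.add_apply, add_mul, one_mul, smul_mul_assoc]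
      rw [h1]
      refine ⟨hleftP _, ?_⟩
      rw [hleft _ (by simp [star_smul, hsa])]
      exact hc₁
    · have h1 : (v - fun i => (1 / 2 : ℂ) • ((1 - a) * v i)) =
          fun i => (1 - (1 / 2 : ℂ) • (1 - a)) * v i := by
        funext i
        simp only [Pi.sub_apply, sub_mul, one_mul, smul_mul_assoc]
      rw [h1]
      refine ⟨hleftP _, ?_⟩
      rw [hleft _ (by simp [star_smul, hsa])]
      exact hc₂
  have haa : a * a = a := by
    calc a * a = ∑ i, a * (v i * star (v i)) := by rw [← Finset.mul_sum]
      _ = ∑ i, v i * star (v i) := Finset.sum_congr rfl fun i _ => by rw [← mul_assoc, hav]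
  have hbb : (1 - a) * (1 - a) = 1 - a := by
    rw [mul_sub, mul_one, sub_mul, one_mul, haa, sub_self, sub_zero]
  have hsb : star (1 - a) = 1 - a := by rw [star_sub, star_one, hsa]
  let Q : ι → ι → N.toStarSubalgebra := fun k j => P k j - star (v k) * v j
  have hQs : ∀ k j, star (Q k j) = Q j k := fun k j => by
    simp only [Q, star_sub, star_mul, star_star, hPs]
  have hvQ : ∀ k, ∑ j, v j * Q j k = 0 := fun k => by
    simp only [Q, mul_sub, Finset.sum_sub_distrib, hvP, ← mul_assoc]
    rw [← Finset.sum_mul, ← ha_def, hav, sub_self]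
  have hQP : ∀ k j, ∑ i, Q k i * P i j = Q k j := fun k j => by
    simp only [Q, sub_mul, Finset.sum_sub_distrib, hPP, mul_assoc]
    rw [← Finset.mul_sum, hvP]
  -- A row of `(1 - a) x Q`, suitably scaled, is orthogonal to `v` and has range under `1 - a`, so
  -- adding or subtracting it keeps `v` in the ball; extremality forces it to vanish. Primeness then
  -- yields `a = 1` or `Q = 0`.
  have hzero : ∀ (x : N.toStarSubalgebra) (k j : ι), (1 - a) * x * Q k j = 0 := by
    intro x k j
    let m : N.toStarSubalgebra := ∑ j, (x * Q k j) * star (x * Q k j)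
    have hm : (0 : H →L[ℂ] H) ≤ m := by
      rw [AddSubmonoidClass.coe_finsetSum]
      exact Finset.sum_nonneg fun i _ => mul_star_self_nonneg ((x * Q k i : N.toStarSubalgebra) : H →L[ℂ] H)
    obtain ⟨s, hs, hsm⟩ := exists_smul_le_one hm
    let y : ι → N.toStarSubalgebra := fun j => (s : ℂ) • ((1 - a) * (x * Q k j))
    have hyP : ∀ j, ∑ i, y i * P i j = y j := fun j => by
      simp only [y, smul_mul_assoc, mul_assoc]
      rw [← Finset.smul_sum, ← Finset.mul_sum, ← Finset.mul_sum, hQP]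
    have hsc : star (s : ℂ) = s := Complex.conj_ofReal s
    have hvy : ∑ j, v j * star (y j) = 0 := by
      have h1 : ∀ j, v j * star (y j) = (s : ℂ) • ((v j * Q j k) * (star x * (1 - a))) := fun j => by
        simp only [y, star_smul, star_mul, hQs, hsb, hsc, mul_smul_comm, mul_assoc]
      simp only [h1]
      rw [← Finset.smul_sum, ← Finset.sum_mul, hvQ, zero_mul, smul_zero]
    have hyv : ∑ j, y j * star (v j) = 0 := by
      have h1 := congrArg star hvy
      simpa only [star_sum, star_mul, star_star, star_zero] using h1
    have hyy : ∑ j, y j * star (y j) = (1 - a) * (((s : ℂ) * s) • m) * (1 - a) := by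
      simp only [m, Finset.smul_sum, Finset.mul_sum, Finset.sum_mul]
      refine Finset.sum_congr rfl fun j _ => ?_
      simp only [y, star_smul, star_mul, hsb, hsc, mul_smul_comm, smul_mul_assoc, smul_smul,
        mul_assoc]
    have hle : ((a + ∑ j, y j * star (y j) : N.toStarSubalgebra) : H →L[ℂ] H) ≤ 1 := by
      rw [hyy]
      have h1 := star_left_conjugate_le_conjugate hsm ((1 - a : N.toStarSubalgebra) : H →L[ℂ] H)
      have h2 : star ((1 - a : N.toStarSubalgebra) : H →L[ℂ] H) =
          ((1 - a : N.toStarSubalgebra) : H →L[ℂ] H) := congrArg Subtype.val hsb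
      have h3 : ((1 - a : N.toStarSubalgebra) : H →L[ℂ] H) *
          ((1 - a : N.toStarSubalgebra) : H →L[ℂ] H) =
          ((1 - a : N.toStarSubalgebra) : H →L[ℂ] H) := congrArg Subtype.val hbb
      rw [h2, mul_one, h3] at h1
      have h4 := add_le_add_right h1 (a : H →L[ℂ] H)
      have h5 : (a : H →L[ℂ] H) + ((1 - a : N.toStarSubalgebra) : H →L[ℂ] H) = 1 :=
        add_sub_cancel (a : H →L[ℂ] H) 1
      rw [h5] at h4
      exact h4
    have hy := hext y ⟨fun j => ?_, ?_⟩ ⟨fun j => ?_, ?_⟩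
    · have h1 := congrFun hy j
      simp only [y, Pi.zero_apply, smul_eq_zero, Complex.ofReal_eq_zero, hs.ne', false_or] at h1
      rw [mul_assoc, h1]
    · simp only [Pi.add_apply, add_mul, Finset.sum_add_distrib, hvP, hyP]
    · have h1 : ∑ i, (v + y) i * star ((v + y) i) = a + ∑ j, y j * star (y j) := by
        simp only [Pi.add_apply, star_add, add_mul, mul_add, Finset.sum_add_distrib, hvy, hyv,
          add_zero, zero_add]
        rw [ha_def]
      rw [h1]
      exact hle
    · simp only [Pi.sub_apply, sub_mul, Finset.sum_sub_distrib, hvP, hyP]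
    · have h1 : ∑ i, (v - y) i * star ((v - y) i) = a + ∑ j, y j * star (y j) := by
        simp only [Pi.sub_apply, star_sub, sub_mul, mul_sub, Finset.sum_sub_distrib, hvy, hyv,
          sub_zero, zero_sub, sub_neg_eq_add]
        rw [ha_def]
      rw [h1]
      exact hle
  refine ⟨v, hvP, ?_⟩
  change a = 1
  by_cases hQ : ∀ k j, Q k j = 0
  -- If `Q = 0` then `P = v* v`, so the trace of `P` equals `τ a ≤ τ 1`, against the hypothesis.
  · exfalso
    have h1 : ∑ i, τ.toLinearMap (P i i) = τ.toLinearMap a := by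
      rw [ha_def, map_sum]
      refine Finset.sum_congr rfl fun i _ => ?_
      rw [sub_eq_zero.1 (hQ i i), τ.trace]
    have h2 := (Complex.le_def.1 (τ.nonneg (1 - a))).1
    rw [hsb, hbb, map_sub, ← h1, Complex.sub_re, Complex.zero_re] at h2
    linarith
  · push Not at hQ
    obtain ⟨k, j, hkj⟩ := hQ
    have h1 : ((1 - a : N.toStarSubalgebra) : H →L[ℂ] H) = 0 :=
      VonNeumannAlgebra.eq_zero_of_mul_mul_eq_zero hN (Q k j).2
        (fun h0 => hkj (Subtype.ext h0))
        fun x hx => congrArg Subtype.val (hzero ⟨x, hx⟩ k j)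
    exact (sub_eq_zero.1 (Subtype.ext h1 : (1 - a : N.toStarSubalgebra) = 0)).symm

end Comparison

/-! ### Transporting projective representations through amplifications -/

section Amplification

variable {H : Type*} [NormedAddCommGroup H] [InnerProductSpace ℂ H] [CompleteSpace H]

theorem FaithfulTrace.re_pos_of_isStarProjection {B : Type*} [Ring B] [StarRing B] [Algebra ℂ B]
    (τ : FaithfulTrace B) {p : B} (hp : IsStarProjection p) (hp0 : p ≠ 0) :
    0 < (τ.toLinearMap p).re := by
  have h1 : star p * p = p := by rw [hp.isSelfAdjoint.star_eq, hp.isIdempotentElem.eq]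
  have h2 := τ.nonneg p
  have h3 : τ.toLinearMap (star p * p) ≠ 0 := fun h => hp0 (τ.faithful p h)
  rw [h1] at h2 h3
  exact (Complex.lt_def.1 (lt_of_le_of_ne h2 h3.symm)).1

/-- A large multiple of a non-zero projection in the matrices over a finite factor `N` dominates a
copy of `1`. -/
theorem exists_rows_of_isStarProjection {N : VonNeumannAlgebra H}
    (hN : ∀ x ∈ N, x ∈ N.commutant → ∃ c : ℂ, x = c • (1 : H →L[ℂ] H))
    (τ : FaithfulTrace N.toStarSubalgebra) {k : ℕ} {p : Matrix (Fin k) (Fin k) N.toStarSubalgebra}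
    (hp : IsStarProjection p) (hp0 : p ≠ 0) :
    ∃ (m : ℕ) (w : Fin m → Fin k → N.toStarSubalgebra),
      (∀ i a, ∑ b, w i b * p b a = w i a) ∧ ∑ i, ∑ a, w i a * star (w i a) = 1 := by
  have htr := (τ.matrix (Fin k)).re_pos_of_isStarProjection hp hp0
  -- Enough copies of `p` for the block diagonal projection to have trace larger than that of `1`.
  obtain ⟨m, hm⟩ := exists_nat_gt ((τ.toLinearMap 1).re / ((τ.matrix (Fin k)).toLinearMap p).re)
  rw [div_lt_iff₀ htr] at hm
  let P : Matrix (Fin k × Fin m) (Fin k × Fin m) N.toStarSubalgebra :=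
    Matrix.blockDiagonal fun _ => p
  have hP : IsStarProjection P := by
    refine ⟨?_, ?_⟩
    · change P * P = P
      rw [← Matrix.blockDiagonal_mul]
      simp only [hp.isIdempotentElem.eq]
      rfl
    · change Pᴴ = P
      rw [Matrix.blockDiagonal_conjTranspose]
      congr 1
      funext _
      exact hp.isSelfAdjoint.star_eq
  obtain ⟨v, hvP, hv⟩ := exists_row_mul_star_eq_one hN τ hP (by
    refine hm.trans_eq ?_
    have h1 : ∑ i, τ.toLinearMap (P i i) = m * (τ.matrix (Fin k)).toLinearMap p := by
      rw [Fintype.sum_prod_type_right]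
      simp only [P, Matrix.blockDiagonal_apply_eq, Finset.sum_const, Finset.card_univ,
        Fintype.card_fin, nsmul_eq_mul]
      congr 1
      simp [FaithfulTrace.matrix, Matrix.trace]
    rw [h1]
    simp)
  refine ⟨m, fun i a => v (a, i), fun i a => ?_, ?_⟩
  · refine Eq.trans ?_ (hvP (a, i))
    rw [Fintype.sum_prod_type]
    refine Finset.sum_congr rfl fun b _ => ?_
    simp [P, Matrix.blockDiagonal_apply]
  · rw [← hv, Fintype.sum_prod_type_right]

/-- Given `∑ wᵢ wᵢ* = 1` with `wᵢ` rows in the range of a projection `p`, every projective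
representation in `A` gives projective representations in the matrices over any algebra that contains
`p M_k(A) p`. -/
theorem exists_projectiveRep_of_rows {A : Type*} [Ring A] [StarRing A] [Algebra ℂ A]
    [StarModule ℂ A] (τ : FaithfulTrace A) {G : Type*} [Group G] {μ : G → G → Circle}
    {u : G → A} (hu : IsProjectiveRep μ u) (hu1 : u 1 = 1) (h1 : (1 : A) ≠ 0)
    {B : Type*} [Ring B] [StarRing B] [Algebra ℂ B] [StarModule ℂ B]
    {k m : ℕ} {p : Matrix (Fin k) (Fin k) A} (hp : IsStarProjection p)
    (f : starCorner p hp →⋆ₙₐ[ℂ] B) (hf : Function.Injective f) {w : Fin m → Fin k → A}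
    (hwp : ∀ i a, ∑ b, w i b * p b a = w i a) (hw : ∑ i, ∑ a, w i a * star (w i a) = 1) :
    ∃ U : G → Matrix (Fin m) (Fin m) B, IsProjectiveRep μ U ∧ U 1 ≠ 0 := by
  have hpw : ∀ i a, ∑ b, p a b * star (w i b) = star (w i a) := fun i a => by
    rw [← hwp i a, star_sum]
    refine Finset.sum_congr rfl fun b _ => ?_
    rw [star_mul, ← Matrix.star_apply, hp.isSelfAdjoint.star_eq]
  -- The matrix `c x` is `W* x W` for the block row `W` of the `w i`; since `W W* = 1`, the map `c`
  -- is multiplicative, and its entries lie in the corner on which `f` is defined.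
  let c : A → Fin m → Fin m → starCorner p hp := fun x i j =>
    ⟨Matrix.of fun a b => star (w i a) * x * w j b, by
      refine ⟨?_, ?_⟩
      · ext a b : 1
        simp only [Matrix.mul_apply, Matrix.of_apply, ← mul_assoc]
        rw [← Finset.sum_mul, ← Finset.sum_mul, hpw]
      · ext a b : 1
        simp only [Matrix.mul_apply, Matrix.of_apply, mul_assoc]
        rw [← Finset.mul_sum, ← Finset.mul_sum, hwp]⟩
  have hcmul : ∀ x y i j, ∑ l, c x i l * c y l j = c (x * y) i j := by
    intro x y i j
    apply Subtype.ext
    rw [AddSubmonoidClass.coe_finsetSum]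
    ext a b : 1
    rw [Matrix.sum_apply]
    change ∑ l, ∑ d, star (w i a) * x * w l d * (star (w l d) * y * w j b) =
      star (w i a) * (x * y) * w j b
    have h2 : star (w i a) * (x * y) * w j b =
        (star (w i a) * x) * (∑ l, ∑ d, w l d * star (w l d)) * (y * w j b) := by
      rw [hw]
      noncomm_ring
    rw [h2]
    simp only [Finset.mul_sum, Finset.sum_mul]
    refine Finset.sum_congr rfl fun l _ => Finset.sum_congr rfl fun d _ => ?_
    noncomm_ring
  have hcstar : ∀ x i j, star (c x j i) = c (star x) i j := by
    intro x i j
    apply Subtype.ext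
    ext a b : 1
    change star (star (w j b) * x * w i a) = star (w i a) * star x * w j b
    rw [star_mul, star_mul, star_star, mul_assoc]
  have hcsmul : ∀ (z : ℂ) x i j, c (z • x) i j = z • c x i j := by
    intro z x i j
    apply Subtype.ext
    ext a b : 1
    change star (w i a) * (z • x) * w j b = z • (star (w i a) * x * w j b)
    rw [mul_smul_comm, smul_mul_assoc]
  refine ⟨fun g => Matrix.of fun i j => f (c (u g) i j), ⟨fun g h => ?_, fun g => ?_⟩, fun h0 => ?_⟩
  · ext i j : 1
    rw [Matrix.mul_apply, Matrix.smul_apply]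
    simp only [Matrix.of_apply]
    simp only [← map_mul]
    rw [← map_sum, hcmul, hu.mul, hcsmul, map_smul]
  · ext i j : 1
    rw [Matrix.star_apply]
    simp only [Matrix.of_apply]
    rw [← map_star, hcstar, hu.star]
  · have h2 : ∀ i a, star (w i a) * w i a = 0 := fun i a => by
      have h3 : f (c (u 1) i i) = 0 := congrFun (congrFun h0 i) i
      have h4 := congrArg Subtype.val (hf (h3.trans (map_zero f).symm))
      have h5 : star (w i a) * u 1 * w i a = 0 := congrFun (congrFun h4 a) a
      rwa [hu1, mul_one] at h5
    refine h1 ?_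
    rw [← hw]
    refine Finset.sum_eq_zero fun i _ => Finset.sum_eq_zero fun a _ => ?_
    have h6 : w i a = 0 := τ.faithful _ (by rw [h2, map_zero])
    rw [h6, zero_mul]

/-- A projective representation in a finite factor `N` gives projective representations in the
matrices over any algebra that contains an amplification of `N`. -/
theorem SomeAmplificationEmbeds.exists_projectiveRep {N : VonNeumannAlgebra H}
    (hN : ∀ x ∈ N, x ∈ N.commutant → ∃ c : ℂ, x = c • (1 : H →L[ℂ] H))
    (τ : FaithfulTrace N.toStarSubalgebra) {G : Type*} [Group G] {μ : G → G → Circle}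
    {u : G → N.toStarSubalgebra} (hu : IsProjectiveRep μ u) (hu1 : u 1 = 1)
    (h1 : (1 : N.toStarSubalgebra) ≠ 0)
    {B : Type*} [Ring B] [StarRing B] [Algebra ℂ B] [StarModule ℂ B]
    (h : SomeAmplificationEmbeds N.toStarSubalgebra B) :
    ∃ (m : ℕ) (U : G → Matrix (Fin m) (Fin m) B), IsProjectiveRep μ U ∧ U 1 ≠ 0 := by
  obtain ⟨k, p, hp, hp0, f, hf⟩ := h
  obtain ⟨m, w, hwp, hw⟩ := exists_rows_of_isStarProjection hN τ hp hp0
  exact ⟨m, exists_projectiveRep_of_rows τ hu hu1 h1 hp f hf hwp hw⟩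

/-- The same for an isomorphism of `N` with an amplification of `B`. -/
theorem StablyIsomorphic.exists_projectiveRep {A B : Type*} [Ring A] [StarRing A] [Algebra ℂ A]
    [StarModule ℂ A] [Ring B] [StarRing B] [Algebra ℂ B] [StarModule ℂ B] {G : Type*} [Group G]
    {μ : G → G → Circle} {u : G → A} (hu : IsProjectiveRep μ u) (hu1 : u 1 = 1)
    (h1 : (1 : A) ≠ 0) (h : StablyIsomorphic A B) :
    ∃ (m : ℕ) (U : G → Matrix (Fin m) (Fin m) B), IsProjectiveRep μ U ∧ U 1 ≠ 0 := by
  obtain ⟨k, p, hp, -, ⟨f⟩⟩ := h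
  refine ⟨k, fun g => (f (u g) : Matrix (Fin k) (Fin k) B), ⟨fun g h => ?_, fun g => ?_⟩,
    fun h0 => h1 ?_⟩
  · rw [← NonUnitalStarSubalgebra.coe_mul, ← map_mul, hu.mul, map_smul]
    rfl
  · rw [← hu.star, map_star]
    rfl
  · rw [← hu1]
    exact f.injective ((Subtype.ext h0).trans (map_zero f).symm)

end Amplification

/-! ### Twisted group von Neumann algebras and their trace -/

section TwistedGroupAlgebra

variable {G : Type*} [Group G] {μ : G → G → Circle}

theorem twistedRegular_apply (μ : G → G → Circle) (g : G) (f : lp (fun _ : G => ℂ) 2) (k : G) :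
    twistedRegular μ g f k = μ g (g⁻¹ * k) * f (g⁻¹ * k) := rfl

theorem twistedRegular_mul (hμ : IsNormalizedCocycle μ) (g h : G) :
    twistedRegular μ g * twistedRegular μ h = (μ g h : ℂ) • twistedRegular μ (g * h) := by
  ext f k
  change (μ g (g⁻¹ * k) : ℂ) * (μ h (h⁻¹ * (g⁻¹ * k)) * f (h⁻¹ * (g⁻¹ * k))) =
    (μ g h : ℂ) * (μ (g * h) ((g * h)⁻¹ * k) * f ((g * h)⁻¹ * k))
  have h1 := hμ.cocycle g h (h⁻¹ * (g⁻¹ * k))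
  rw [mul_inv_cancel_left] at h1
  have h2 := congrArg (fun z : Circle => (z : ℂ)) h1
  simp only [Circle.coe_mul] at h2
  rw [mul_inv_rev, mul_assoc h⁻¹]
  linear_combination -f (h⁻¹ * (g⁻¹ * k)) * h2

theorem twistedRegular_one (hμ : IsNormalizedCocycle μ) : twistedRegular μ 1 = 1 := by
  ext f k
  change (μ 1 (1⁻¹ * k) : ℂ) * f (1⁻¹ * k) = f k
  rw [hμ.one_left, inv_one, one_mul, Circle.coe_one, one_mul]

theorem norm_twistedRegular (μ : G → G → Circle) (g : G) (f : lp (fun _ : G => ℂ) 2) :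
    ‖twistedRegular μ g f‖ = ‖f‖ := by
  rw [twistedRegular, LinearIsometry.coe_toContinuousLinearMap, LinearIsometry.norm_map]

/-- An isometry with a right inverse has that inverse as its adjoint; normalization on `(g, g⁻¹)`
removes the scalar. -/
theorem twistedRegular_star (hμ : IsNormalizedCocycle μ) (g : G) :
    star (twistedRegular μ g) = twistedRegular μ g⁻¹ := by
  have h1 : twistedRegular μ g * twistedRegular μ g⁻¹ = 1 := by
    rw [twistedRegular_mul hμ, hμ.mul_inv, mul_inv_cancel, twistedRegular_one hμ, Circle.coe_one,
      one_smul]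
  have h2 : star (twistedRegular μ g) * twistedRegular μ g = 1 :=
    (ContinuousLinearMap.norm_map_iff_adjoint_comp_self _).1 (norm_twistedRegular μ g)
  rw [← mul_one (star _), ← h1, ← mul_assoc, h2, one_mul]

theorem twistedRightTranslate_memℓp (μ : G → G → Circle) (g : G) (f : lp (fun _ : G => ℂ) 2) :
    Memℓp (fun k : G => (μ (k * g⁻¹) g : ℂ) * f (k * g⁻¹)) 2 := by
  have h := (memℓp_gen_iff (by norm_num : 0 < (2 : ℝ≥0∞).toReal)).1 (lp.memℓp f)
  refine (memℓp_gen_iff (by norm_num)).2 ?_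
  simpa [Function.comp_def, Circle.norm_coe] using (Equiv.mulRight g⁻¹).summable_iff.2 h

/-- The right regular representation `ξ_h ↦ μ(h, g) ξ_{hg}`. -/
noncomputable def twistedRight (μ : G → G → Circle) (g : G) :
    lp (fun _ : G => ℂ) 2 →L[ℂ] lp (fun _ : G => ℂ) 2 :=
  LinearIsometry.toContinuousLinearMap
    { toFun := fun f =>
        ⟨fun k => (μ (k * g⁻¹) g : ℂ) * f (k * g⁻¹), twistedRightTranslate_memℓp μ g f⟩
      map_add' := fun f f' => by
        ext k
        exact mul_add _ _ _
      map_smul' := fun c f => by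
        ext k
        exact mul_left_comm _ _ _
      norm_map' := fun f => by
        rw [lp.norm_eq_tsum_rpow (by norm_num : 0 < (2 : ℝ≥0∞).toReal),
          lp.norm_eq_tsum_rpow (by norm_num : 0 < (2 : ℝ≥0∞).toReal)]
        congr 1
        simpa [Circle.norm_coe] using
          (Equiv.mulRight g⁻¹).tsum_eq (fun k => ‖f k‖ ^ (2 : ℝ≥0∞).toReal) }

theorem twistedRight_apply (μ : G → G → Circle) (g : G) (f : lp (fun _ : G => ℂ) 2) (k : G) :
    twistedRight μ g f k = μ (k * g⁻¹) g * f (k * g⁻¹) := rfl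

/-- This is the cocycle identity for the triple `(a, a⁻¹ k g⁻¹, g)`. It places the right
translations in the commutant. -/
theorem twistedRegular_mul_twistedRight (hμ : IsNormalizedCocycle μ) (a g : G) :
    twistedRegular μ a * twistedRight μ g = twistedRight μ g * twistedRegular μ a := by
  ext f k
  change (μ a (a⁻¹ * k) : ℂ) * (μ (a⁻¹ * k * g⁻¹) g * f (a⁻¹ * k * g⁻¹)) =
    μ (k * g⁻¹) g * (μ a (a⁻¹ * (k * g⁻¹)) * f (a⁻¹ * (k * g⁻¹)))
  have h1 := hμ.cocycle a (a⁻¹ * k * g⁻¹) g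
  rw [inv_mul_cancel_right, mul_assoc a⁻¹, mul_inv_cancel_left] at h1
  have h2 := congrArg (fun z : Circle => (z : ℂ)) h1
  simp only [Circle.coe_mul] at h2
  rw [mul_assoc a⁻¹]
  linear_combination -f (a⁻¹ * (k * g⁻¹)) * h2

theorem mem_twistedGroupVN_iff {x : lp (fun _ : G => ℂ) 2 →L[ℂ] lp (fun _ : G => ℂ) 2} :
    x ∈ twistedGroupVN μ ↔ x ∈ StarSubalgebra.centralizer ℂ
      (StarSubalgebra.centralizer ℂ (Set.range (twistedRegular μ)) :
        Set (lp (fun _ : G => ℂ) 2 →L[ℂ] lp (fun _ : G => ℂ) 2)) := Iff.rfl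

theorem twistedRegular_mem (μ : G → G → Circle) (g : G) :
    twistedRegular μ g ∈ twistedGroupVN μ := by
  rw [mem_twistedGroupVN_iff, (StarSubalgebra.mem_centralizer_iff ℂ)]
  intro z hz
  have h := (StarSubalgebra.mem_centralizer_iff ℂ).1 hz _ ⟨g, rfl⟩
  refine ⟨h.1.symm, ?_⟩
  have h2 := congrArg star h.2
  rwa [star_mul, star_mul, star_star] at h2

theorem mul_twistedRight_of_mem (hμ : IsNormalizedCocycle μ)
    {x : lp (fun _ : G => ℂ) 2 →L[ℂ] lp (fun _ : G => ℂ) 2} (hx : x ∈ twistedGroupVN μ) (g : G) :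
    x * twistedRight μ g = twistedRight μ g * x := by
  rw [mem_twistedGroupVN_iff, (StarSubalgebra.mem_centralizer_iff ℂ)] at hx
  refine (hx (twistedRight μ g) ?_).1.symm
  refine (StarSubalgebra.mem_centralizer_iff ℂ).2 ?_
  rintro _ ⟨a, rfl⟩
  rw [twistedRegular_star hμ]
  exact ⟨twistedRegular_mul_twistedRight hμ a g, twistedRegular_mul_twistedRight hμ a⁻¹ g⟩

/-- The canonical unitaries of a twisted group von Neumann algebra. -/
noncomputable def twistedUnitary (μ : G → G → Circle) (g : G) :
    (twistedGroupVN μ).toStarSubalgebra :=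
  ⟨twistedRegular μ g, twistedRegular_mem μ g⟩

theorem twistedUnitary_isProjectiveRep (hμ : IsNormalizedCocycle μ) :
    IsProjectiveRep μ (twistedUnitary μ) where
  mul g h := Subtype.ext (twistedRegular_mul hμ g h)
  star g := Subtype.ext (twistedRegular_star hμ g)

theorem twistedUnitary_one (hμ : IsNormalizedCocycle μ) : twistedUnitary μ 1 = 1 :=
  Subtype.ext (twistedRegular_one hμ)

variable [DecidableEq G]

theorem twistedRegular_single (hμ : IsNormalizedCocycle μ) (g : G) :
    twistedRegular μ g (lp.single 2 1 1) = lp.single 2 g (1 : ℂ) := by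
  ext k
  rw [twistedRegular_apply, lp.single_apply, lp.single_apply]
  by_cases h : k = g
  · subst h
    rw [inv_mul_cancel, Pi.single_eq_same, Pi.single_eq_same, hμ.one_right, Circle.coe_one, one_mul]
  · rw [Pi.single_eq_of_ne h, Pi.single_eq_of_ne (by rwa [Ne, inv_mul_eq_one, eq_comm]), mul_zero]

theorem twistedRight_single (hμ : IsNormalizedCocycle μ) (g : G) :
    twistedRight μ g (lp.single 2 1 1) = lp.single 2 g (1 : ℂ) := by
  ext k
  rw [twistedRight_apply, lp.single_apply, lp.single_apply]
  by_cases h : k = g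
  · subst h
    rw [mul_inv_cancel, Pi.single_eq_same, Pi.single_eq_same, hμ.one_left, Circle.coe_one, one_mul]
  · rw [Pi.single_eq_of_ne h, Pi.single_eq_of_ne (by rwa [Ne, mul_inv_eq_one]), mul_zero]

section Mem

variable {x y : lp (fun _ : G => ℂ) 2 →L[ℂ] lp (fun _ : G => ℂ) 2}

/-- Since `x` commutes with right translations, the vector `x ξ₁` determines all columns of `x`, so
it serves as a Fourier expansion. -/
theorem apply_single_of_mem (hμ : IsNormalizedCocycle μ) (hx : x ∈ twistedGroupVN μ) (g k : G) :
    x (lp.single 2 g (1 : ℂ)) k = μ (k * g⁻¹) g * x (lp.single 2 1 (1 : ℂ)) (k * g⁻¹) := by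
  have h := congrArg (fun T => T (lp.single 2 1 (1 : ℂ))) (mul_twistedRight_of_mem hμ hx g)
  have h' : x (twistedRight μ g (lp.single 2 1 (1 : ℂ))) =
    twistedRight μ g (x (lp.single 2 1 (1 : ℂ))) := h
  rw [twistedRight_single hμ] at h'
  rw [h', twistedRight_apply]

theorem eq_of_apply_single_eq (hμ : IsNormalizedCocycle μ) (hx : x ∈ twistedGroupVN μ)
    (hy : y ∈ twistedGroupVN μ) (h : x (lp.single 2 1 (1 : ℂ)) = y (lp.single 2 1 (1 : ℂ))) :
    x = y := by
  have h1 : ∀ g, x (lp.single 2 g (1 : ℂ)) = y (lp.single 2 g (1 : ℂ)) := fun g => by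
    ext k
    rw [apply_single_of_mem hμ hx, apply_single_of_mem hμ hy, h]
  have h2 : ∀ g (c : ℂ), x (lp.single 2 g c) = y (lp.single 2 g c) := fun g c => by
    have h3 : lp.single 2 g c = c • lp.single (E := fun _ : G => ℂ) 2 g (1 : ℂ) := by
      rw [← lp.single_smul, smul_eq_mul, mul_one]
    rw [h3, map_smul, map_smul, h1]
  ext1 f
  have hf := lp.hasSum_single (E := fun _ : G => ℂ) (p := 2) (by norm_num) f
  refine (hf.mapL x).unique ?_
  simp only [h2]
  exact hf.mapL y

theorem star_apply_single_of_mem (hμ : IsNormalizedCocycle μ) (hx : x ∈ twistedGroupVN μ) (g : G) :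
    star x (lp.single 2 1 (1 : ℂ)) g = (starRingEnd ℂ) (x (lp.single 2 1 (1 : ℂ)) g⁻¹) := by
  have h1 : ⟪lp.single 2 g (1 : ℂ), star x (lp.single 2 1 (1 : ℂ))⟫_ℂ =
      ⟪x (lp.single 2 g (1 : ℂ)), lp.single 2 1 (1 : ℂ)⟫_ℂ :=
    ContinuousLinearMap.adjoint_inner_right x _ _
  rw [lp.inner_single_left, lp.inner_single_right, apply_single_of_mem hμ hx, one_mul] at h1
  have h2 := hμ.mul_inv g⁻¹
  rw [inv_inv] at h2
  rw [h2, Circle.coe_one, one_mul] at h1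
  simpa using h1

/-- In Fourier coefficients both sides are sums of products of the coefficients at `g⁻¹` and `g`,
exchanged by the substitution `g ↦ g⁻¹`. -/
theorem inner_single_mul_comm (hμ : IsNormalizedCocycle μ) (hx : x ∈ twistedGroupVN μ)
    (hy : y ∈ twistedGroupVN μ) :
    ⟪lp.single 2 1 (1 : ℂ), (x * y) (lp.single 2 1 (1 : ℂ))⟫_ℂ =
      ⟪lp.single 2 1 (1 : ℂ), (y * x) (lp.single 2 1 (1 : ℂ))⟫_ℂ := by
  have h1 : ∀ {x y : lp (fun _ : G => ℂ) 2 →L[ℂ] lp (fun _ : G => ℂ) 2}, x ∈ twistedGroupVN μ →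
      ⟪lp.single 2 1 (1 : ℂ), (x * y) (lp.single 2 1 (1 : ℂ))⟫_ℂ =
        ∑' g, x (lp.single 2 1 (1 : ℂ)) g⁻¹ * y (lp.single 2 1 (1 : ℂ)) g := by
    intro x y hx
    have h2 : ⟪lp.single 2 1 (1 : ℂ), (x * y) (lp.single 2 1 (1 : ℂ))⟫_ℂ =
        ⟪star x (lp.single 2 1 (1 : ℂ)), y (lp.single 2 1 (1 : ℂ))⟫_ℂ :=
      (ContinuousLinearMap.adjoint_inner_left x _ _).symm
    rw [h2, lp.inner_eq_tsum]
    refine tsum_congr fun g => ?_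
    rw [star_apply_single_of_mem hμ hx, RCLike.inner_apply, starRingEnd_self_apply, mul_comm]
  rw [h1 hx, h1 hy, ← (Equiv.inv G).tsum_eq]
  refine tsum_congr fun g => ?_
  rw [Equiv.inv_apply, inv_inv, mul_comm]

end Mem

/-- The canonical trace `x ↦ ⟨ξ₁, x ξ₁⟩` of a twisted group von Neumann algebra. -/
noncomputable def twistedTrace (μ : G → G → Circle) :
    (twistedGroupVN μ).toStarSubalgebra →ₗ[ℂ] ℂ :=
  (innerSL ℂ (lp.single 2 1 (1 : ℂ) : lp (fun _ : G => ℂ) 2)).toLinearMap ∘ₗ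
    (ContinuousLinearMap.apply ℂ (lp (fun _ : G => ℂ) 2)
      (lp.single 2 1 (1 : ℂ) : lp (fun _ : G => ℂ) 2)).toLinearMap ∘ₗ
    (twistedGroupVN μ).toStarSubalgebra.toSubalgebra.toSubmodule.subtype

theorem twistedTrace_apply (x : (twistedGroupVN μ).toStarSubalgebra) :
    twistedTrace μ x = ⟪lp.single 2 1 (1 : ℂ),
      (x : lp (fun _ : G => ℂ) 2 →L[ℂ] lp (fun _ : G => ℂ) 2) (lp.single 2 1 (1 : ℂ))⟫_ℂ := rfl

theorem twistedTrace_isFaithfulNormalTrace (hμ : IsNormalizedCocycle μ) :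
    IsFaithfulNormalTrace (twistedTrace μ) := by
  have hstar : ∀ x : (twistedGroupVN μ).toStarSubalgebra, twistedTrace μ (star x * x) =
      ((‖(x : lp (fun _ : G => ℂ) 2 →L[ℂ] lp (fun _ : G => ℂ) 2)
        (lp.single 2 1 (1 : ℂ))‖ ^ 2 : ℝ) : ℂ) := fun x => by
    have h1 : twistedTrace μ (star x * x) =
        ⟪(x : lp (fun _ : G => ℂ) 2 →L[ℂ] lp (fun _ : G => ℂ) 2) (lp.single 2 1 (1 : ℂ)),
          (x : lp (fun _ : G => ℂ) 2 →L[ℂ] lp (fun _ : G => ℂ) 2) (lp.single 2 1 (1 : ℂ))⟫_ℂ := by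
      rw [twistedTrace_apply]
      exact ContinuousLinearMap.adjoint_inner_right
        (x : lp (fun _ : G => ℂ) 2 →L[ℂ] lp (fun _ : G => ℂ) 2) _ _
    rw [h1, inner_self_eq_norm_sq_to_K]
    push_cast
    rfl
  constructor
  · refine ⟨fun i => if i = 0 then lp.single 2 1 (1 : ℂ) else 0,
      fun i => if i = 0 then lp.single 2 1 (1 : ℂ) else 0, ?_, ?_, fun x => ?_⟩
    · exact summable_of_ne_finset_zero (s := {0}) fun i hi => by
        beta_reduce
        rw [if_neg (by simpa using hi), norm_zero, zero_pow two_ne_zero]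
    · exact summable_of_ne_finset_zero (s := {0}) fun i hi => by
        beta_reduce
        rw [if_neg (by simpa using hi), norm_zero, zero_pow two_ne_zero]
    · exact hasSum_single 0 fun i hi => by
        beta_reduce
        rw [if_neg hi, inner_zero_left]
  · change ⟪lp.single 2 1 (1 : ℂ), lp.single (E := fun _ : G => ℂ) 2 1 (1 : ℂ)⟫_ℂ = 1
    rw [lp.inner_single_left, lp.single_apply_self]
    simp
  · exact fun x y => inner_single_mul_comm hμ x.2 y.2
  · intro x
    rw [hstar]
    exact Complex.zero_le_real.2 (sq_nonneg _)
  · intro x hx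
    rw [hstar] at hx
    have h1 : (x : lp (fun _ : G => ℂ) 2 →L[ℂ] lp (fun _ : G => ℂ) 2) (lp.single 2 1 (1 : ℂ)) = 0 := by
      have h2 : ‖(x : lp (fun _ : G => ℂ) 2 →L[ℂ] lp (fun _ : G => ℂ) 2)
          (lp.single 2 1 (1 : ℂ))‖ ^ 2 = 0 := by exact_mod_cast hx
      exact norm_eq_zero.1 (pow_eq_zero_iff two_ne_zero |>.1 h2)
    refine Subtype.ext (eq_of_apply_single_eq hμ x.2 (zero_mem (twistedGroupVN μ)) ?_)
    rw [h1]
    rfl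

/-- The coefficients of a central element are invariant under twisted conjugation. -/
theorem central_coeff (hμ : IsNormalizedCocycle μ)
    {x : lp (fun _ : G => ℂ) 2 →L[ℂ] lp (fun _ : G => ℂ) 2} (hx : x ∈ twistedGroupVN μ)
    (hx' : x ∈ (twistedGroupVN μ).commutant) (g h : G) :
    (μ (g * h * g⁻¹) g : ℂ) * x (lp.single 2 1 (1 : ℂ)) (g * h * g⁻¹) =
      μ g h * x (lp.single 2 1 (1 : ℂ)) h := by
  have h1 := VonNeumannAlgebra.mem_commutant_iff.1 hx' _ (twistedRegular_mem μ g)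
  have h2 : twistedRegular μ g (x (lp.single 2 1 (1 : ℂ))) =
      x (twistedRegular μ g (lp.single 2 1 (1 : ℂ))) :=
    congrArg (fun T => T (lp.single 2 1 (1 : ℂ))) h1
  rw [twistedRegular_single hμ] at h2
  have h3 := congrArg (fun f : lp (fun _ : G => ℂ) 2 => f (g * h)) h2
  beta_reduce at h3
  rw [twistedRegular_apply, inv_mul_cancel_left, apply_single_of_mem hμ hx g (g * h)] at h3
  exact h3.symm

theorem separableSpace_lp (ι : Type*) [Countable ι] :
    TopologicalSpace.SeparableSpace (lp (fun _ : ι => ℂ) 2) := by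
  classical
  let v : ι → lp (fun _ : ι => ℂ) 2 := fun i => lp.single 2 i (1 : ℂ)
  have hs : TopologicalSpace.IsSeparable
      (closure (Submodule.span ℂ (Set.range v) : Set (lp (fun _ : ι => ℂ) 2))) :=
    ((Set.countable_range v).isSeparable.span (R := ℂ)).closure
  rw [← TopologicalSpace.isSeparable_univ_iff]
  refine hs.mono fun f _ => ?_
  refine mem_closure_of_tendsto (lp.hasSum_single (E := fun _ : ι => ℂ) (p := 2) (by norm_num) f)
    (Filter.Eventually.of_forall fun s => ?_)
  refine Submodule.sum_mem _ fun i _ => ?_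
  have h3 : lp.single 2 i (f i) = f i • v i := by
    rw [← lp.single_smul, smul_eq_mul, mul_one]
  rw [h3]
  exact Submodule.smul_mem _ _ (Submodule.subset_span ⟨i, rfl⟩)

end TwistedGroupAlgebra

/-! ### Triviality of the centre away from roots of unity -/

section Center

variable {n : ℕ} {Γ : Subgroup (Matrix.symplecticGroup (Fin n) ℤ)} {β : Circle}

theorem exists_symplecticForm_ne_zero {z : ZLattice n} (hz : z ≠ 0) :
    ∃ y, symplecticForm z y ≠ 0 := by
  classical
  obtain ⟨i, hi⟩ := Function.ne_iff.1 hz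
  rcases i with i | i
  · refine ⟨Pi.single (.inr i) 1, ?_⟩
    rw [symplecticForm_eq_sum]
    simpa [Pi.single_apply] using hi
  · refine ⟨Pi.single (.inl i) 1, ?_⟩
    rw [symplecticForm_eq_sum]
    simpa [Pi.single_apply] using hi

theorem exists_mulVec_ne {A : Matrix.symplecticGroup (Fin n) ℤ} (hA : A ≠ 1) :
    ∃ y : ZLattice n, (A : Matrix (Fin n ⊕ Fin n) (Fin n ⊕ Fin n) ℤ) *ᵥ y ≠ y := by
  classical
  by_contra! h
  refine hA (Subtype.ext (Matrix.ext_of_mulVec_single fun i => ?_))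
  rw [h, Submonoid.coe_one, Matrix.one_mulVec]

theorem LatticeSemidirect.conj_inl_left (y : ZLattice n) (h : LatticeSemidirect n Γ) :
    Multiplicative.toAdd (SemidirectProduct.inl (Multiplicative.ofAdd y) * h *
      (SemidirectProduct.inl (Multiplicative.ofAdd y))⁻¹).left =
    Multiplicative.toAdd h.left +
      (y - (h.right.1 : Matrix (Fin n ⊕ Fin n) (Fin n ⊕ Fin n) ℤ) *ᵥ y) := by
  rw [← map_inv, LatticeSemidirect.toAdd_left_mul, LatticeSemidirect.toAdd_left_mul,
    LatticeSemidirect.mulVec_mul, ← ofAdd_neg]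
  simp only [SemidirectProduct.left_inl, SemidirectProduct.right_inl, toAdd_ofAdd, OneMemClass.coe_one,
    Matrix.one_mulVec, Matrix.mulVec_neg]
  abel

/-- A function in `ℓ²` vanishes where its modulus is constant on an infinite set. -/
theorem lp_eq_zero_of_norm_eq {ι : Type*} (f : lp (fun _ : ι => ℂ) 2) {c : ℝ} {s : ℕ → ι}
    (hs : Function.Injective s) (h : ∀ k, ‖f (s k)‖ = c) : c = 0 := by
  have h1 := (memℓp_gen_iff (by norm_num : 0 < (2 : ℝ≥0∞).toReal)).1 (lp.memℓp f)
  have h2 := (h1.comp_injective hs).tendsto_atTop_zero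
  simp only [Function.comp_def, h] at h2
  have h3 := tendsto_nhds_unique h2 tendsto_const_nhds
  exact ((Real.rpow_eq_zero (by rw [← h 0]; exact norm_nonneg _) (by norm_num)).1 h3.symm)

/-- Conjugation by lattice elements alone kills every Fourier coefficient of a central element
except that at `1`, so nothing is required of `Γ`. -/
theorem cocycleVN_center_trivial (hβ : ¬ IsOfFinOrder (β ^ 2)) :
    ∀ x ∈ cocycleVN Γ β, x ∈ (cocycleVN Γ β).commutant →
      ∃ c : ℂ, x = c • (1 : lp (fun _ : LatticeSemidirect n Γ => ℂ) 2 →L[ℂ]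
        lp (fun _ : LatticeSemidirect n Γ => ℂ) 2) := by
  classical
  intro x hx hx'
  have hμ := latticeCocycle_isNormalized Γ β
  have hconj := central_coeff hμ hx hx'
  set f : lp (fun _ : LatticeSemidirect n Γ => ℂ) 2 := x (lp.single 2 1 (1 : ℂ)) with hf
  have hzero : ∀ h, h ≠ 1 → f h = 0 := by
    intro h hne
    -- In the lattice, conjugation by `y` fixes `z` but multiplies its coefficient by a power of
    -- `β²` with exponent `± symplecticForm z y`, non-zero for a suitable `y`.
    by_cases hr : h.right = 1
    · have hz : Multiplicative.toAdd h.left ≠ 0 := fun h0 =>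
        hne (SemidirectProduct.ext h0 hr)
      obtain ⟨y, hy⟩ := exists_symplecticForm_ne_zero hz
      have hh : h = SemidirectProduct.inl (Multiplicative.ofAdd (Multiplicative.toAdd h.left)) :=
        SemidirectProduct.ext rfl hr
      generalize Multiplicative.toAdd h.left = z at hy hh
      subst hh
      by_contra hfz
      have h1 := hconj (SemidirectProduct.inl (Multiplicative.ofAdd y))
        (SemidirectProduct.inl (Multiplicative.ofAdd z))
      have h2 : (SemidirectProduct.inl (Multiplicative.ofAdd y) *
          SemidirectProduct.inl (Multiplicative.ofAdd z) *
          (SemidirectProduct.inl (Multiplicative.ofAdd y))⁻¹ : LatticeSemidirect n Γ) =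
          SemidirectProduct.inl (Multiplicative.ofAdd z) := by
        rw [← map_inv, ← map_mul, ← map_mul, mul_comm, inv_mul_cancel_left]
      rw [h2] at h1
      have h3 := Circle.coe_injective (mul_right_cancel₀ hfz h1)
      rw [latticeCocycle_inl, latticeCocycle_inl, symplecticForm_swap z y] at h3
      refine hβ (isOfFinOrder_iff_zpow_eq_one.2 ⟨symplecticForm z y, hy, ?_⟩)
      rw [← zpow_natCast, ← zpow_mul, mul_comm, Nat.cast_ofNat, mul_two, zpow_add]
      nth_rewrite 1 [h3]
      rw [← zpow_add, neg_add_cancel, zpow_zero]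
    -- Off the lattice, conjugation by `k y` translates the lattice part by `k (y - γ y)`: an
    -- infinite orbit on which the modulus of the coefficient is constant.
    · obtain ⟨y, hy⟩ := exists_mulVec_ne (A := h.right.1) fun h0 => hr (Subtype.ext h0)
      let g : ℕ → LatticeSemidirect n Γ := fun k =>
        SemidirectProduct.inl (Multiplicative.ofAdd ((k : ℤ) • y))
      refine norm_eq_zero.1 (lp_eq_zero_of_norm_eq f (s := fun k => g k * h * (g k)⁻¹) ?_ fun k => ?_)
      · intro k l hkl
        have h1 := congrArg (fun a : LatticeSemidirect n Γ => Multiplicative.toAdd a.left) hkl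
        simp only [g] at h1
        rw [LatticeSemidirect.conj_inl_left, LatticeSemidirect.conj_inl_left, add_right_inj,
          Matrix.mulVec_smul, Matrix.mulVec_smul, ← smul_sub, ← smul_sub] at h1
        exact Nat.cast_injective (smul_left_injective ℤ (sub_ne_zero.2 hy.symm) h1)
      · have h1 := congrArg norm (hconj (g k) h)
        rwa [norm_mul, norm_mul, Circle.norm_coe, Circle.norm_coe, one_mul, one_mul] at h1
  refine ⟨f 1, eq_of_apply_single_eq hμ hx
    ((cocycleVN Γ β).toStarSubalgebra.smul_mem (one_mem _) _) ?_⟩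
  ext h
  change f h = f 1 * (lp.single 2 1 (1 : ℂ) : lp (fun _ : LatticeSemidirect n Γ => ℂ) 2) h
  rw [lp.single_apply]
  by_cases h1 : h = 1
  · rw [h1, Pi.single_eq_same, mul_one]
  · rw [hzero h h1, Pi.single_eq_of_ne h1, mul_zero]

end Center

theorem twistedGroupVN_one_ne_zero {G : Type*} [Group G] {μ : G → G → Circle}
    (hμ : IsNormalizedCocycle μ) : (1 : (twistedGroupVN μ).toStarSubalgebra) ≠ 0 := by
  classical
  intro h
  have h1 := (twistedTrace_isFaithfulNormalTrace hμ).map_one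
  rw [h, map_zero] at h1
  exact zero_ne_one h1

/-! ### The theorem -/

/-- `r` is a choice of square roots `α ↦ α^{1/2}` on the circle, so that
`cocycleVN Γ (r α)` is `M_α(Γ, n)`. -/
theorem corollary2p3 (n : ℕ) (hn : 1 ≤ n)
    (Γ : Subgroup (Matrix.symplecticGroup (Fin n) ℤ))
    (hT : HasRelativePropertyT (latticeSubgroup n Γ))
    (r : Circle → Circle) (hr : ∀ α, r α ^ 2 = α) :
    (∀ (H : Type*) [NormedAddCommGroup H] [InnerProductSpace ℂ H] [CompleteSpace H]
        [TopologicalSpace.SeparableSpace H] (M : VonNeumannAlgebra H), IsIIOneFactor M →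
        {α : Circle | SomeAmplificationEmbeds
          (cocycleVN Γ (r α)).toStarSubalgebra M.toStarSubalgebra}.Countable) ∧
      ∀ α₀ : Circle, {α : Circle | StablyIsomorphic
          (cocycleVN Γ (r α)).toStarSubalgebra (cocycleVN Γ (r α₀)).toStarSubalgebra}.Countable := by
  classical
  have hμ := fun α => latticeCocycle_isNormalized Γ (r α)
  refine ⟨fun H _ _ _ _ M hM => ?_, fun α₀ => ?_⟩
  · obtain ⟨τ, hτ⟩ := hM.exists_trace
    -- Roots of unity are added wholesale, since comparison of projections needs a trivial centre;
    -- they form a countable set.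
    refine (Circle.countable_isOfFinOrder.union (countable_projectiveReps hn hT hr hτ)).mono
      fun α hα => ?_
    by_cases hfin : IsOfFinOrder α
    · exact Or.inl hfin
    · exact Or.inr (SomeAmplificationEmbeds.exists_projectiveRep
        (cocycleVN_center_trivial (by rwa [hr]))
        (twistedTrace_isFaithfulNormalTrace (hμ α)).toFaithfulTrace
        (twistedUnitary_isProjectiveRep (hμ α)) (twistedUnitary_one (hμ α))
        (twistedGroupVN_one_ne_zero (hμ α)) hα)
  -- The first assertion is not invoked, because `α₀` may be a root of unity and factoriality of the
  -- target is then unavailable; its trace and the separability of `ℓ²(G)` are enough.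
  · have := separableSpace_lp (LatticeSemidirect n Γ)
    exact (countable_projectiveReps hn hT hr (twistedTrace_isFaithfulNormalTrace (hμ α₀))).mono
      fun α hα => StablyIsomorphic.exists_projectiveRep (twistedUnitary_isProjectiveRep (hμ α))
        (twistedUnitary_one (hμ α)) (twistedGroupVN_one_ne_zero (hμ α)) hα
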